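/- Let $n\ge 1$, let $\gamma\in(0,\infty)$ be not an integer, $[\gamma]=\gamma-\lfloor\gamma\rfloor$, $k=\lfloor\gamma\rfloor+1$, $s=\frac n2+\gamma$, and write $\mathbb B=\mathbb B^{n+1}$ for the open unit ball of $\mathbb R^{n+1}$, $\mathbb S^n=\partial\mathbb B$. **Operators.** Put $\rho=\frac{2(1-|x|)}{1+|x|}$, $\Delta_+=\frac{1-|x|^2}{4}\big[(1-|x|^2)\Delta_{\mathbb R^{n+1}}+2(n-1)\sum_i x_i\partial_{x_i}\big]$ (the Laplace–Beltrami operator of the Poincaré metric $\frac{4|dx|^2}{(1-|x|^2)^2}$), $D_t=-\Delta_+-t(n-t)$ and $$L_{2k}U=\rho^{-\frac n2+\gamma-2k}\prod_{j=0}^{k-1}D_{s-2j}\big(\rho^{\frac n2-\gamma}U\big).$$ "$L_{2k}U=0$" means that $\rho^{\frac n2-\gamma}U\in C^{2k}(\mathbb B)$ and $L_{2k}U=0$ at every point of $\mathbb B$. **Function space.** $C^\infty_{\rm even}(\overline{\mathbb B})$ is the set of $f\in C^\infty(\overline{\mathbb B})$ with a boundary expansion $f=f_0+\rho^2f_2+\rho^4f_4+\cdots$,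 $f_{2i}\in C^\infty(\mathbb S^n)$, and $\mathcal C^{2\gamma}(\overline{\mathbb B})=C^\infty_{\rm even}(\overline{\mathbb B})+\rho^{2[\gamma]}C^\infty_{\rm even}(\overline{\mathbb B})$. **GJMS operators.** For $f=\sum_{l}Y_l\in C^\infty(\mathbb S^n)$ with $Y_l$ a spherical harmonic of degree $l$, $P_{2\alpha}f=\sum_{l\ge0}\frac{\Gamma(l+\frac n2+\alpha)}{\Gamma(l+\frac n2-\alpha)}Y_l$, where $1/\Gamma=0$ at the poles of $\Gamma$. Put $c_\alpha=\frac{2^{2\alpha}\Gamma(\alpha)}{\Gamma(-\alpha)}$. **Boundary operators of small index.** For $0\le j\le\lfloor\gamma/2\rfloor$, $$B^{2\gamma}_{2j}U=\frac1{b_{2j}}\,\rho^{-\frac n2+\gamma-2j}\prod_{l=0}^{j-1}D_{s-2l}\prod_{l=\lfloor\gamma\rfloor-j+1}^{\lfloor\gamma\rfloor}D_{s-2l}\big(\rho^{\frac n2-\gamma}U\big)\Big|_{\rho=0}$$ (so $B^{2\gamma}_0U=U|_{\rho=0}$), and for $0\le j\le\lfloor\gamma\rfloor-\lfloor\gamma/2\rfloor-1$,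 $$B^{2\gamma}_{2j+2[\gamma]}U=\frac{-1}{b_{2j+2[\gamma]}}\,\rho^{-\frac n2+\gamma-2j-2[\gamma]}\prod_{l=0}^{j}D_{s-2l}\prod_{l=\lfloor\gamma\rfloor-j+1}^{\lfloor\gamma\rfloor}D_{s-2l}\big(\rho^{\frac n2-\gamma}U\big)\Big|_{\rho=0},$$ where $$b_{2j}=4^{2j}j!\,\tfrac{\Gamma(j+1-[\gamma])}{\Gamma(1-[\gamma])}\tfrac{\Gamma(\gamma+1-j)}{\Gamma(\gamma+1-2j)}\tfrac{\Gamma(\lfloor\gamma\rfloor+1-j)}{\Gamma(\lfloor\gamma\rfloor+1-2j)},\qquad b_{2j+2[\gamma]}=-4^{2j+1}j!\,\tfrac{\Gamma(j+1+[\gamma])}{\Gamma([\gamma])}\tfrac{\Gamma(\lfloor\gamma\rfloor+1-j)}{\Gamma(\lfloor\gamma\rfloor-2j)}\tfrac{\Gamma(\lfloor\gamma\rfloor+1-j-[\gamma])}{\Gamma(\lfloor\gamma\rfloor+1-2j-[\gamma])}$$ are the constants for which $B^{2\gamma}_{2j}(\rho^{2j})=B^{2\gamma}_{2j+2[\gamma]}(\rho^{2j+2[\gamma]})=1$.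 **Boundary operators of large index.** Let $\tilde U\in\mathcal C^{2\gamma}(\overline{\mathbb B})$ be the polyharmonic extension of $U$: $L_{2k}\tilde U=0$, and $\tilde U$ and $U$ have the same image under every boundary operator of small index. Let $\Pi_j=\prod_{0\le l\le\lfloor\gamma\rfloor,\,l\ne j}D_{s-2l}$. For $\lfloor\gamma/2\rfloor+1\le j\le\lfloor\gamma\rfloor$, $$B^{2\gamma}_{2j}U=\frac1{b_{2j}}\,\rho^{-\frac n2+\gamma-2j}\,\Pi_j\big(\rho^{\frac n2-\gamma}(U-\tilde U)\big)\Big|_{\rho=0}+\frac1{c_{2j-\gamma}}P_{4j-2\gamma}B^{2\gamma}_{2\gamma-2j}U,$$ and for $\lfloor\gamma\rfloor-\lfloor\gamma/2\rfloor\le j\le\lfloor\gamma\rfloor$, $$B^{2\gamma}_{2j+2[\gamma]}U=\frac1{b_{2j+2[\gamma]}}\,\rho^{-\frac n2+\gamma-2j-2[\gamma]}\,\Pi_{\lfloor\gamma\rfloor-j}\big(\rho^{\frac n2-\gamma}(U-\tilde U)\big)\Big|_{\rho=0}+\frac1{c_{2j+[\gamma]-\lfloor\gamma\rfloor}}P_{4j+2[\gamma]-2\lfloor\gamma\rfloor}B^{2\gamma}_{2\lfloor\gamma\rfloor-2j}U,$$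 where for these large indices $b_{2j}=(-1)^{\lfloor\gamma\rfloor}\prod_{i\ne j}\big((\gamma-2j)^2-(\gamma-2i)^2\big)$ and $b_{2j+2[\gamma]}=(-1)^{\lfloor\gamma\rfloor}\prod_{i\ne\lfloor\gamma\rfloor-j}\big((\gamma-2j-2[\gamma])^2-(\gamma-2i)^2\big)$, with $0\le i\le\lfloor\gamma\rfloor$. **Theorem 1.4.** For any $U\in\mathcal C^{2\gamma}(\overline{\mathbb B})$ satisfying $L_{2k}U=0$, the boundary values in the definitions above exist, and $$B^{2\gamma}_{2\gamma-2j}(U)=\frac1{c_{\gamma-2j}}P_{2\gamma-4j}B^{2\gamma}_{2j}(U)\qquad\text{for }0\le j\le\lfloor\gamma/2\rfloor,$$ $$B^{2\gamma}_{2\lfloor\gamma\rfloor-2j}(U)=\frac1{c_{\lfloor\gamma\rfloor-[\gamma]-2j}}P_{2\lfloor\gamma\rfloor-2[\gamma]-4j}B^{2\gamma}_{2[\gamma]+2j}(U)\qquad\text{for }0\le j\le\lfloor\gamma\rfloor-\lfloor\gamma/2\rfloor-1.$$ -/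

import Mathlib

open Set Filter Topology Metric MeasureTheory
open scoped ContDiff Manifold

noncomputable section

namespace PoincareBall

/-- The ambient space `ℝ^{n+1}` with its Euclidean norm. -/
abbrev Amb (n : ℕ) : Type := EuclideanSpace ℝ (Fin (n + 1))

/-- The sphere `𝕊ⁿ`. -/
abbrev Sph (n : ℕ) : Type := sphere (0 : Amb n) 1

/-- The open unit ball `𝔹^{n+1}`. -/
abbrev openBall (n : ℕ) : Set (Amb n) := ball 0 1

instance finrankAmb (n : ℕ) : Fact (Module.finrank ℝ (Amb n) = n + 1) := ⟨by simp⟩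

/-! ### Defining function, hyperbolic Laplacian and the operators `L_{2k}` -/

/-- The geodesic normal defining function `ρ = 2 (1 - |x|) / (1 + |x|)`. -/
def rho {n : ℕ} (x : Amb n) : ℝ := 2 * (1 - ‖x‖) / (1 + ‖x‖)

/-- The Laplace-Beltrami operator of the Poincaré metric `4 |dx|² / (1 - |x|²)²`:
`Δ₊ = (1 - |x|²)/4 · ((1 - |x|²) Δ + 2 (n - 1) ∑ xᵢ ∂ᵢ)`. -/
def hypLaplacian (n : ℕ) (u : Amb n → ℝ) (x : Amb n) : ℝ :=
  (1 - ‖x‖ ^ 2) / 4 *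
    ((1 - ‖x‖ ^ 2) * Laplacian.laplacian u x + 2 * ((n : ℝ) - 1) * fderiv ℝ u x x)

/-- `D_s = -Δ₊ - s (n - s)`. -/
def opD (n : ℕ) (s : ℝ) (u : Amb n → ℝ) (x : Amb n) : ℝ :=
  -hypLaplacian n u x - s * ((n : ℝ) - s) * u x

/-- The product `∏_{l ∈ L} D_{s - 2 l}`, with `s = n/2 + γ`. -/
def prodD (n : ℕ) (γ : ℝ) (L : List ℕ) (u : Amb n → ℝ) : Amb n → ℝ :=
  L.foldr (fun l v => opD n ((n : ℝ) / 2 + γ - 2 * (l : ℝ)) v) u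

/-- `ρ^{n/2 - γ} U`. -/
def weighted (n : ℕ) (γ : ℝ) (U : Amb n → ℝ) (x : Amb n) : ℝ :=
  rho x ^ ((n : ℝ) / 2 - γ) * U x

/-- `L_{2k} = ρ^{-n/2 + γ - 2k} ∘ ∏_{j=0}^{k-1} D_{s - 2j} ∘ ρ^{n/2 - γ}`, with `k = ⌊γ⌋ + 1`. -/
def opL (n : ℕ) (γ : ℝ) (U : Amb n → ℝ) (x : Amb n) : ℝ :=
  rho x ^ (-(n : ℝ) / 2 + γ - 2 * ((⌊γ⌋₊ : ℝ) + 1)) *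
    prodD n γ (List.range (⌊γ⌋₊ + 1)) (weighted n γ U) x

/-- `U` solves `L_{2k} U = 0` in the whole open ball, in the classical sense: the function
`ρ^{n/2 - γ} U`, to which the operator `∏ D_{s - 2j}` of order `2k` with smooth coefficients is
applied, is of class `C^{2k}`, and the equation holds at every point. (`ρ` itself is not smooth at
the origin.) -/
def SolvesL (n : ℕ) (γ : ℝ) (U : Amb n → ℝ) : Prop :=
  ContDiffOn ℝ ((2 * (⌊γ⌋₊ + 1) : ℕ) : WithTop ℕ∞) (weighted n γ U) (openBall n) ∧
    ∀ x ∈ openBall n, opL n γ U x = 0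

/-! ### Function spaces -/

/-- `f ∈ C^∞_even`: `f` is smooth on the closed ball and has an expansion
`f = f₀ + ρ² f₂ + ρ⁴ f₄ + ⋯` at the boundary with `f_{2i} = a i ∈ C^∞(𝕊ⁿ)`. -/
def SmoothEven (n : ℕ) (f : Amb n → ℝ) : Prop :=
  ContDiffOn ℝ ∞ f (closedBall 0 1) ∧
    ∃ a : ℕ → Sph n → ℝ,
      (∀ i, ContMDiff (𝓡 n) 𝓘(ℝ, ℝ) ∞ (a i)) ∧
      ∀ N : ℕ, ∃ C : ℝ, ∀ ξ : Sph n, ∀ r ∈ Icc (0 : ℝ) 1,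
        |f (r • (ξ : Amb n)) - ∑ i ∈ Finset.range N, rho (r • (ξ : Amb n)) ^ (2 * i) * a i ξ|
          ≤ C * rho (r • (ξ : Amb n)) ^ (2 * N)

/-- `𝒞^{2γ} = C^∞_even + ρ^{2[γ]} C^∞_even` on the closed ball. -/
def MemC (n : ℕ) (γ : ℝ) (U : Amb n → ℝ) : Prop :=
  ∃ A B : Amb n → ℝ, SmoothEven n A ∧ SmoothEven n B ∧
    ∀ x ∈ closedBall (0 : Amb n) 1, U x = A x + rho x ^ (2 * Int.fract γ) * B x

/-! ### Spherical harmonics and GJMS operators -/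

/-- `Y ∈ ℋ_l`: `Y` is the restriction to `𝕊ⁿ` of a harmonic homogeneous polynomial of
degree `l`. -/
def IsSphericalHarmonic (n l : ℕ) (Y : Sph n → ℝ) : Prop :=
  ∃ p : MvPolynomial (Fin (n + 1)) ℝ, p.IsHomogeneous l ∧
    ∑ i, MvPolynomial.pderiv i (MvPolynomial.pderiv i p) = 0 ∧
    ∀ ξ : Sph n, Y ξ = MvPolynomial.eval (fun i => (ξ : Amb n) i) p

/-- `Y` is the `L²(𝕊ⁿ)`-orthogonal projection of `f` to `ℋ_l`. -/
def IsHarmonicPart (n l : ℕ) (f Y : Sph n → ℝ) : Prop :=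
  IsSphericalHarmonic n l Y ∧ ∀ Z : Sph n → ℝ, IsSphericalHarmonic n l Z →
    ∫ ξ, f ξ * Z ξ ∂(volume : Measure (Amb n)).toSphere =
      ∫ ξ, Y ξ * Z ξ ∂(volume : Measure (Amb n)).toSphere

open Classical in
/-- The component `Y_l` in the expansion `f = ∑ Y_l` in spherical harmonics. It exists and is unique
for continuous `f`, since `ℋ_l` has finite dimension. -/
def harmonicPart (n l : ℕ) (f : Sph n → ℝ) : Sph n → ℝ :=
  if h : ∃ Y, IsHarmonicPart n l f Y then h.choose else 0

/-- The GJMS operator `P_{2γ} f = ∑_l Γ(l + n/2 + γ) / Γ(l + n/2 - γ) Y_l` for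
`f = ∑ Y_l ∈ C^∞(𝕊ⁿ)`; for such `f` the `Y_l` decay rapidly and the series converges absolutely.
`1 / Γ` is `0` at the poles of `Γ`. -/
def gjms (n : ℕ) (γ : ℝ) (f : Sph n → ℝ) (ξ : Sph n) : ℝ :=
  ∑' l : ℕ, Real.Gamma ((l : ℝ) + (n : ℝ) / 2 + γ) / Real.Gamma ((l : ℝ) + (n : ℝ) / 2 - γ) *
    harmonicPart n l f ξ

/-- `c_γ = 2^{2γ} Γ(γ) / Γ(-γ)`. -/
def cConst (γ : ℝ) : ℝ := 2 ^ (2 * γ) * Real.Gamma γ / Real.Gamma (-γ)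

/-! ### Boundary values -/

/-- `F|_{ρ = 0}` exists: `F`, defined in the open ball, has a limit at every boundary point. -/
def HasTrace {n : ℕ} (F : Amb n → ℝ) : Prop :=
  ∀ ξ : Sph n, ∃ y : ℝ, Tendsto F (𝓝[openBall n] (ξ : Amb n)) (𝓝 y)

/-- The boundary value `F|_{ρ = 0}`. -/
def trace {n : ℕ} (F : Amb n → ℝ) (ξ : Sph n) : ℝ :=
  limUnder (𝓝[openBall n] (ξ : Amb n)) F

/-! ### Boundary operators of small index -/

/-- The normalizing constant of `B_{2j}` for `0 ≤ j ≤ ⌊γ/2⌋`. -/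
def bEvenLow (γ : ℝ) (j : ℕ) : ℝ :=
  4 ^ (2 * j) * (j.factorial : ℝ) *
    (Real.Gamma (j + 1 - Int.fract γ) / Real.Gamma (1 - Int.fract γ)) *
    (Real.Gamma (γ + 1 - j) / Real.Gamma (γ + 1 - 2 * j)) *
    (Real.Gamma ((⌊γ⌋₊ : ℝ) + 1 - j) / Real.Gamma ((⌊γ⌋₊ : ℝ) + 1 - 2 * j))

/-- The normalizing constant of `B_{2j + 2[γ]}` for `0 ≤ j ≤ ⌊γ⌋ - ⌊γ/2⌋ - 1`, chosen such that
`B_{2j + 2[γ]} (ρ^{2j + 2[γ]}) = 1`. -/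
def bFracLow (γ : ℝ) (j : ℕ) : ℝ :=
  -(4 ^ (2 * j + 1) * (j.factorial : ℝ) *
    (Real.Gamma (j + 1 + Int.fract γ) / Real.Gamma (Int.fract γ)) *
    (Real.Gamma ((⌊γ⌋₊ : ℝ) + 1 - j) / Real.Gamma ((⌊γ⌋₊ : ℝ) - 2 * j)) *
    (Real.Gamma ((⌊γ⌋₊ : ℝ) + 1 - j - Int.fract γ) /
      Real.Gamma ((⌊γ⌋₊ : ℝ) + 1 - 2 * j - Int.fract γ)))

/-- `ρ^{-n/2 + γ - 2j} ∏_{l=0}^{j-1} D_{s-2l} ∏_{l=⌊γ⌋-j+1}^{⌊γ⌋} D_{s-2l} (ρ^{n/2-γ} U)`. -/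
def evenLowInterior (n : ℕ) (γ : ℝ) (j : ℕ) (U : Amb n → ℝ) (x : Amb n) : ℝ :=
  rho x ^ (-(n : ℝ) / 2 + γ - 2 * (j : ℝ)) *
    prodD n γ (List.range j ++ List.Ico (⌊γ⌋₊ - j + 1) (⌊γ⌋₊ + 1)) (weighted n γ U) x

/-- `ρ^{-n/2+γ-2j-2[γ]} ∏_{l=0}^{j} D_{s-2l} ∏_{l=⌊γ⌋-j+1}^{⌊γ⌋} D_{s-2l} (ρ^{n/2-γ} U)`. -/
def fracLowInterior (n : ℕ) (γ : ℝ) (j : ℕ) (U : Amb n → ℝ) (x : Amb n) : ℝ :=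
  rho x ^ (-(n : ℝ) / 2 + γ - 2 * (j : ℝ) - 2 * Int.fract γ) *
    prodD n γ (List.range (j + 1) ++ List.Ico (⌊γ⌋₊ - j + 1) (⌊γ⌋₊ + 1)) (weighted n γ U) x

/-- `B_{2j}` for `0 ≤ j ≤ ⌊γ/2⌋`. For `j = 0` this is `U|_{ρ = 0}`. -/
def bdryEvenLow (n : ℕ) (γ : ℝ) (j : ℕ) (U : Amb n → ℝ) (ξ : Sph n) : ℝ :=
  1 / bEvenLow γ j * trace (evenLowInterior n γ j U) ξ

/-- `B_{2j + 2[γ]}` for `0 ≤ j ≤ ⌊γ⌋ - ⌊γ/2⌋ - 1`. -/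
def bdryFracLow (n : ℕ) (γ : ℝ) (j : ℕ) (U : Amb n → ℝ) (ξ : Sph n) : ℝ :=
  -1 / bFracLow γ j * trace (fracLowInterior n γ j U) ξ

/-! ### Polyharmonic extension -/

/-- `V` is a polyharmonic extension of `U`: it solves `L_{2k} V = 0` and has the same boundary
data of small index as `U`. -/
def IsPolyExt (n : ℕ) (γ : ℝ) (U V : Amb n → ℝ) : Prop :=
  MemC n γ V ∧ SolvesL n γ V ∧
    (∀ j : ℕ, j ≤ ⌊γ / 2⌋₊ → ∀ ξ, bdryEvenLow n γ j V ξ = bdryEvenLow n γ j U ξ) ∧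
    (∀ m : ℕ, m < ⌊γ⌋₊ - ⌊γ / 2⌋₊ → ∀ ξ, bdryFracLow n γ m V ξ = bdryFracLow n γ m U ξ)

open Classical in
/-- The polyharmonic extension `Ũ` of `U` (the solution of a Dirichlet problem). -/
def polyExt (n : ℕ) (γ : ℝ) (U : Amb n → ℝ) : Amb n → ℝ :=
  if h : ∃ V, IsPolyExt n γ U V then h.choose else 0

/-! ### Boundary operators of large index -/

/-- `b_{2j} = (-1)^{⌊γ⌋} ∏_{i ≠ j} ((γ - 2j)² - (γ - 2i)²)`. -/
def bEvenHigh (γ : ℝ) (j : ℕ) : ℝ :=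
  (-1) ^ ⌊γ⌋₊ * ∏ i ∈ (Finset.range (⌊γ⌋₊ + 1)).erase j,
    ((γ - 2 * (j : ℝ)) ^ 2 - (γ - 2 * (i : ℝ)) ^ 2)

/-- `b_{2j+2[γ]} = (-1)^{⌊γ⌋} ∏_{i ≠ ⌊γ⌋ - j} ((γ - 2j - 2[γ])² - (γ - 2i)²)`. -/
def bFracHigh (γ : ℝ) (j : ℕ) : ℝ :=
  (-1) ^ ⌊γ⌋₊ * ∏ i ∈ (Finset.range (⌊γ⌋₊ + 1)).erase (⌊γ⌋₊ - j),
    ((γ - 2 * (j : ℝ) - 2 * Int.fract γ) ^ 2 - (γ - 2 * (i : ℝ)) ^ 2)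

/-- `Π_j = ∏_{0 ≤ l ≤ ⌊γ⌋, l ≠ j} D_{s - 2l}`. -/
def opPi (n : ℕ) (γ : ℝ) (j : ℕ) (u : Amb n → ℝ) : Amb n → ℝ :=
  prodD n γ (List.range j ++ List.Ico (j + 1) (⌊γ⌋₊ + 1)) u

/-- `ρ^{-n/2 + γ - 2j} Π_j (ρ^{n/2 - γ} (U - Ũ))`. -/
def evenHighInterior (n : ℕ) (γ : ℝ) (j : ℕ) (U : Amb n → ℝ) (x : Amb n) : ℝ :=
  rho x ^ (-(n : ℝ) / 2 + γ - 2 * (j : ℝ)) *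
    opPi n γ j (weighted n γ (U - polyExt n γ U)) x

/-- `ρ^{-n/2 + γ - 2j - 2[γ]} Π_{⌊γ⌋-j} (ρ^{n/2 - γ} (U - Ũ))`. -/
def fracHighInterior (n : ℕ) (γ : ℝ) (j : ℕ) (U : Amb n → ℝ) (x : Amb n) : ℝ :=
  rho x ^ (-(n : ℝ) / 2 + γ - 2 * (j : ℝ) - 2 * Int.fract γ) *
    opPi n γ (⌊γ⌋₊ - j) (weighted n γ (U - polyExt n γ U)) x

/-- `B_{2j}` for `⌊γ/2⌋ + 1 ≤ j ≤ ⌊γ⌋`; here `2γ - 2j = 2(⌊γ⌋ - j) + 2[γ]` is a small index. -/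
def bdryEvenHigh (n : ℕ) (γ : ℝ) (j : ℕ) (U : Amb n → ℝ) (ξ : Sph n) : ℝ :=
  1 / bEvenHigh γ j * trace (evenHighInterior n γ j U) ξ +
    1 / cConst (2 * j - γ) * gjms n (2 * j - γ) (bdryFracLow n γ (⌊γ⌋₊ - j) U) ξ

/-- `B_{2j + 2[γ]}` for `⌊γ⌋ - ⌊γ/2⌋ ≤ j ≤ ⌊γ⌋`. -/
def bdryFracHigh (n : ℕ) (γ : ℝ) (j : ℕ) (U : Amb n → ℝ) (ξ : Sph n) : ℝ :=
  1 / bFracHigh γ j * trace (fracHighInterior n γ j U) ξ +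
    1 / cConst (2 * j + Int.fract γ - ⌊γ⌋₊) *
      gjms n (2 * j + Int.fract γ - ⌊γ⌋₊) (bdryEvenLow n γ (⌊γ⌋₊ - j) U) ξ

/-! ### The boundary operators -/

/-- `B^{2γ}_{2j}` for `0 ≤ j ≤ ⌊γ⌋`. -/
def bdryEven (n : ℕ) (γ : ℝ) (j : ℕ) (U : Amb n → ℝ) : Sph n → ℝ :=
  if j ≤ ⌊γ / 2⌋₊ then bdryEvenLow n γ j U else bdryEvenHigh n γ j U

/-- `B^{2γ}_{2j + 2[γ]}` for `0 ≤ j ≤ ⌊γ⌋`. -/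
def bdryFrac (n : ℕ) (γ : ℝ) (j : ℕ) (U : Amb n → ℝ) : Sph n → ℝ :=
  if j < ⌊γ⌋₊ - ⌊γ / 2⌋₊ then bdryFracLow n γ j U else bdryFracHigh n γ j U

/-- The boundary values in the definitions of all the operators `B^{2γ}_{2j}` and
`B^{2γ}_{2j + 2[γ]}`, `0 ≤ j ≤ ⌊γ⌋`, exist for `U`. -/
def BoundaryValuesExist (n : ℕ) (γ : ℝ) (U : Amb n → ℝ) : Prop :=
  (∀ j : ℕ, j ≤ ⌊γ / 2⌋₊ → HasTrace (evenLowInterior n γ j U)) ∧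
  (∀ j : ℕ, j < ⌊γ⌋₊ - ⌊γ / 2⌋₊ → HasTrace (fracLowInterior n γ j U)) ∧
  (∀ j : ℕ, ⌊γ / 2⌋₊ < j → j ≤ ⌊γ⌋₊ → HasTrace (evenHighInterior n γ j U)) ∧
  (∀ j : ℕ, ⌊γ⌋₊ - ⌊γ / 2⌋₊ ≤ j → j ≤ ⌊γ⌋₊ → HasTrace (fracHighInterior n γ j U))

end PoincareBall

end

open PoincareBall

noncomputable section

namespace PoincareBall

/-! Each boundary operator of large index is a trace of an expression in `U - Ũ` plus exactly the
GJMS term that the theorem asserts. So everything follows once `Ũ = U` in the open ball and the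
traces are known to exist; the GJMS series itself is never evaluated. Since `U` is an admissible
extension of its own data, `Ũ = U` amounts to uniqueness for the Dirichlet problem
(`IsPolyExt.eqOn`).

Uniqueness: let `w` be `ρ^{n/2-γ}` times the difference of two solutions with equal data of small
index. The lists of factors in the small-index operators form a chain from the empty list to the
full product, each adding one factor, alternately `D_{s-2j}` and `D_{s-2(⌊γ⌋-j)}`. The full product
kills `w`, and factors are removed one by one: if `D_{n/2+τ} v = 0`, the vanishing of the
corresponding trace says precisely that `v = o(ρ^{n/2-|τ|})`, where `n/2-|τ|` is the smaller
indicial root, and comparison with a positive supersolution of that growth gives `v = 0`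
(`eq_zero_of_opD_eq_zero`).

Existence of traces: conjugating `D_{n/2+τ}` by `ρ^b` sends a function `G` even in `ρ` to `(τ² -
(b-n/2)²) G + ρ² H` with `H` even (`EvenSum.conjD_eq`). Hence a factor with indicial root `b` raises
the leading exponent by two and any other factor preserves it, which brings both summands of `U` up
to the weight of the trace. Remainders of the expansion are controlled by interpolation
(`isBigO_fderivWithin`): every factor divides the order of vanishing by four, which is harmless
because expansions of every order are available. -/

variable {n : ℕ}

/-! ### Laplacian in coordinates -/

/-- The standard orthonormal basis of `Amb n`. -/
abbrev stdBasis (n : ℕ) : OrthonormalBasis (Fin (n + 1)) ℝ (Amb n) :=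
  EuclideanSpace.basisFun (Fin (n + 1)) ℝ

theorem laplacian_apply (u : Amb n → ℝ) (x : Amb n) :
    Laplacian.laplacian u x =
      ∑ i, fderiv ℝ (fderiv ℝ u) x (stdBasis n i) (stdBasis n i) := by
  rw [InnerProductSpace.laplacian_eq_iteratedFDeriv_orthonormalBasis u (stdBasis n)]
  simp only [iteratedFDeriv_two_apply]
  rfl

theorem contDiffAt_two_fderiv {E F : Type*} [NormedAddCommGroup E] [NormedSpace ℝ E]
    [NormedAddCommGroup F] [NormedSpace ℝ F] {f : E → F} {x : E} (hf : ContDiffAt ℝ 2 f x) :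
    DifferentiableAt ℝ (fderiv ℝ f) x :=
  (hf.fderiv_right (m := 1) (by norm_num)).differentiableAt (by norm_num)

theorem eventually_differentiableAt {E F : Type*} [NormedAddCommGroup E] [NormedSpace ℝ E]
    [NormedAddCommGroup F] [NormedSpace ℝ F] {f : E → F} {x : E} (hf : ContDiffAt ℝ 2 f x) :
    ∀ᶠ y in 𝓝 x, DifferentiableAt ℝ f y := by
  filter_upwards [hf.eventually (by simp)] with y hy using hy.differentiableAt (by norm_num)

theorem fderiv_fderiv_mul {f g : Amb n → ℝ} {x : Amb n} (hf : ContDiffAt ℝ 2 f x)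
    (hg : ContDiffAt ℝ 2 g x) (v : Amb n) :
    fderiv ℝ (fderiv ℝ (fun y => f y * g y)) x v v =
      f x * fderiv ℝ (fderiv ℝ g) x v v + 2 * (fderiv ℝ f x v * fderiv ℝ g x v) +
        g x * fderiv ℝ (fderiv ℝ f) x v v := by
  have h1 : fderiv ℝ (fun y => f y * g y) =ᶠ[𝓝 x]
      fun y => f y • fderiv ℝ g y + g y • fderiv ℝ f y := by
    filter_upwards [eventually_differentiableAt hf, eventually_differentiableAt hg] with y h1 h2
    exact fderiv_fun_mul h1 h2
  have df := hf.differentiableAt (by norm_num)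
  have dg := hg.differentiableAt (by norm_num)
  have h2 : HasFDerivAt (fun y => f y • fderiv ℝ g y + g y • fderiv ℝ f y) _ x :=
    (df.hasFDerivAt.smul (contDiffAt_two_fderiv hg).hasFDerivAt).add
      (dg.hasFDerivAt.smul (contDiffAt_two_fderiv hf).hasFDerivAt)
  rw [h1.fderiv_eq, h2.fderiv]
  simp
  ring

theorem laplacian_mul {f g : Amb n → ℝ} {x : Amb n} (hf : ContDiffAt ℝ 2 f x)
    (hg : ContDiffAt ℝ 2 g x) :
    Laplacian.laplacian (fun y => f y * g y) x =
      f x * Laplacian.laplacian g x +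
        2 * ∑ i, fderiv ℝ f x (stdBasis n i) * fderiv ℝ g x (stdBasis n i) +
        g x * Laplacian.laplacian f x := by
  simp only [laplacian_apply, fderiv_fderiv_mul hf hg, Finset.sum_add_distrib, Finset.mul_sum]

/-! ### Radial functions -/

/-- Using `‖x‖ ^ 2` as the radial variable avoids the singularity of the norm at the origin, so that
the supersolutions below are treated on the whole ball. -/
theorem hasFDerivAt_radial {F : ℝ → ℝ} {F' : ℝ} {x : Amb n} (hF : HasDerivAt F F' (‖x‖ ^ 2)) :
    HasFDerivAt (fun y : Amb n => F (‖y‖ ^ 2)) ((2 * F') • innerSL ℝ x) x := by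
  have h := hF.comp_hasFDerivAt x (hasStrictFDerivAt_norm_sq x).hasFDerivAt
  refine h.congr_fderiv ?_
  ext v
  simp
  ring

theorem contDiffAt_radial {m : WithTop ℕ∞} {F : ℝ → ℝ} {x : Amb n}
    (hF : ContDiffAt ℝ m F (‖x‖ ^ 2)) : ContDiffAt ℝ m (fun y : Amb n => F (‖y‖ ^ 2)) x :=
  ContDiffAt.comp x hF ((contDiff_norm_sq ℝ).contDiffAt)

theorem fderiv_radial_apply {F : ℝ → ℝ} {F' : ℝ} {x : Amb n} (hF : HasDerivAt F F' (‖x‖ ^ 2))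
    (v : Amb n) : fderiv ℝ (fun y : Amb n => F (‖y‖ ^ 2)) x v = 2 * F' * inner ℝ x v := by
  rw [(hasFDerivAt_radial hF).fderiv]
  simp

theorem tendsto_normSq (x : Amb n) : Tendsto (fun y : Amb n => ‖y‖ ^ 2) (𝓝 x) (𝓝 (‖x‖ ^ 2)) :=
  (continuous_norm.pow 2).tendsto x

theorem fderiv_fderiv_radial {F F₁ : ℝ → ℝ} {F₂ : ℝ} {x : Amb n}
    (h1 : ∀ᶠ s in 𝓝 (‖x‖ ^ 2), HasDerivAt F (F₁ s) s) (h2 : HasDerivAt F₁ F₂ (‖x‖ ^ 2))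
    (v : Amb n) :
    fderiv ℝ (fderiv ℝ (fun y : Amb n => F (‖y‖ ^ 2))) x v v =
      4 * F₂ * (inner ℝ x v) ^ 2 + 2 * F₁ (‖x‖ ^ 2) * ‖v‖ ^ 2 := by
  have e : fderiv ℝ (fun y : Amb n => F (‖y‖ ^ 2)) =ᶠ[𝓝 x]
      fun y => (2 * F₁ (‖y‖ ^ 2)) • innerSL ℝ y := by
    filter_upwards [(tendsto_normSq x).eventually h1] with y hy
    exact (hasFDerivAt_radial hy).fderiv
  have hd := ((hasFDerivAt_radial h2).const_mul 2).smul (innerSL ℝ (E := Amb n)).hasFDerivAt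
  rw [e.fderiv_eq]
  erw [hd.fderiv]
  have i1 : innerSL ℝ v v = ‖v‖ ^ 2 := real_inner_self_eq_norm_sq v
  have i2 : innerSL ℝ x v = inner ℝ x v := rfl
  simp
  rw [i1, i2]
  ring

theorem laplacian_radial {F F₁ : ℝ → ℝ} {F₂ : ℝ} {x : Amb n}
    (h1 : ∀ᶠ s in 𝓝 (‖x‖ ^ 2), HasDerivAt F (F₁ s) s) (h2 : HasDerivAt F₁ F₂ (‖x‖ ^ 2)) :
    Laplacian.laplacian (fun y : Amb n => F (‖y‖ ^ 2)) x =
      4 * F₂ * ‖x‖ ^ 2 + 2 * ((n : ℝ) + 1) * F₁ (‖x‖ ^ 2) := by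
  rw [laplacian_apply]
  simp only [fderiv_fderiv_radial h1 h2, Finset.sum_add_distrib, ← Finset.mul_sum,
    OrthonormalBasis.norm_eq_one]
  have : ∑ i, (inner ℝ x (stdBasis n i)) ^ 2 = ‖x‖ ^ 2 := by
    rw [← (stdBasis n).sum_sq_norm_inner_left x]
    simp
  rw [this]
  simp
  ring

/-! ### The hyperbolic Laplacian -/

theorem sum_inner_mul_basis (x : Amb n) (A : Amb n →L[ℝ] ℝ) :
    ∑ i, inner ℝ x (stdBasis n i) * A (stdBasis n i) = A x := by
  conv_rhs => rw [← (stdBasis n).sum_repr x, map_sum]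
  refine Finset.sum_congr rfl fun i _ => ?_
  rw [map_smul, smul_eq_mul, OrthonormalBasis.repr_apply_apply, real_inner_comm]

/-- Leibniz rule for the product of a radial function with an arbitrary function. -/
theorem hypLaplacian_radial_mul {F F₁ : ℝ → ℝ} {F₂ : ℝ} {g : Amb n → ℝ} {x : Amb n}
    (hF : ContDiffAt ℝ 2 F (‖x‖ ^ 2))
    (h1 : ∀ᶠ s in 𝓝 (‖x‖ ^ 2), HasDerivAt F (F₁ s) s) (h2 : HasDerivAt F₁ F₂ (‖x‖ ^ 2))
    (hg : ContDiffAt ℝ 2 g x) :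
    hypLaplacian n (fun y => F (‖y‖ ^ 2) * g y) x =
      F (‖x‖ ^ 2) * hypLaplacian n g x +
        (1 - ‖x‖ ^ 2) ^ 2 * F₁ (‖x‖ ^ 2) * fderiv ℝ g x x +
        ((1 - ‖x‖ ^ 2) ^ 2 * ‖x‖ ^ 2 * F₂ +
          (1 - ‖x‖ ^ 2) ^ 2 * ((n : ℝ) + 1) / 2 * F₁ (‖x‖ ^ 2) +
          (1 - ‖x‖ ^ 2) * ((n : ℝ) - 1) * ‖x‖ ^ 2 * F₁ (‖x‖ ^ 2)) * g x := by
  have hf := contDiffAt_radial hF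
  have h1x := h1.self_of_nhds
  unfold hypLaplacian
  rw [laplacian_mul hf hg, laplacian_radial h1 h2,
    fderiv_fun_mul (hf.differentiableAt (by norm_num)) (hg.differentiableAt (by norm_num))]
  simp only [fderiv_radial_apply h1x]
  have : ∑ i, 2 * F₁ (‖x‖ ^ 2) * inner ℝ x (stdBasis n i) * fderiv ℝ g x (stdBasis n i) =
      2 * F₁ (‖x‖ ^ 2) * fderiv ℝ g x x := by
    rw [← sum_inner_mul_basis x (fderiv ℝ g x), Finset.mul_sum]
    exact Finset.sum_congr rfl fun i _ => by ring
  rw [this]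
  simp [fderiv_radial_apply h1x]
  ring

theorem hypLaplacian_radial {F F₁ : ℝ → ℝ} {F₂ : ℝ} {x : Amb n}
    (h1 : ∀ᶠ s in 𝓝 (‖x‖ ^ 2), HasDerivAt F (F₁ s) s) (h2 : HasDerivAt F₁ F₂ (‖x‖ ^ 2)) :
    hypLaplacian n (fun y : Amb n => F (‖y‖ ^ 2)) x =
      (1 - ‖x‖ ^ 2) ^ 2 * ‖x‖ ^ 2 * F₂ +
          (1 - ‖x‖ ^ 2) ^ 2 * ((n : ℝ) + 1) / 2 * F₁ (‖x‖ ^ 2) +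
          (1 - ‖x‖ ^ 2) * ((n : ℝ) - 1) * ‖x‖ ^ 2 * F₁ (‖x‖ ^ 2) := by
  unfold hypLaplacian
  rw [laplacian_radial h1 h2, fderiv_radial_apply h1.self_of_nhds, real_inner_self_eq_norm_sq]
  ring

theorem hypLaplacian_congr {u v : Amb n → ℝ} {x : Amb n} (h : u =ᶠ[𝓝 x] v) :
    hypLaplacian n u x = hypLaplacian n v x := by
  unfold hypLaplacian
  rw [(InnerProductSpace.laplacian_congr_nhds h).self_of_nhds, h.fderiv_eq]

theorem hypLaplacian_add {u v : Amb n → ℝ} {x : Amb n} (hu : ContDiffAt ℝ 2 u x)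
    (hv : ContDiffAt ℝ 2 v x) :
    hypLaplacian n (u + v) x = hypLaplacian n u x + hypLaplacian n v x := by
  unfold hypLaplacian
  rw [hu.laplacian_add hv, fderiv_add (hu.differentiableAt (by norm_num))
    (hv.differentiableAt (by norm_num))]
  simp
  ring

theorem hypLaplacian_const_mul {u : Amb n → ℝ} {x : Amb n} (c : ℝ) (hu : ContDiffAt ℝ 2 u x) :
    hypLaplacian n (fun y => c * u y) x = c * hypLaplacian n u x := by
  have h : (fun y => c * u y) = c • u := rfl
  unfold hypLaplacian
  rw [h, InnerProductSpace.laplacian_smul c hu, fderiv_const_smul (hu.differentiableAt (by norm_num))]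
  simp
  ring

theorem opD_congr {u v : Amb n → ℝ} {x : Amb n} (s : ℝ) (h : u =ᶠ[𝓝 x] v) :
    opD n s u x = opD n s v x := by
  unfold opD
  rw [hypLaplacian_congr h, h.self_of_nhds]

theorem opD_add {u v : Amb n → ℝ} {x : Amb n} (s : ℝ) (hu : ContDiffAt ℝ 2 u x)
    (hv : ContDiffAt ℝ 2 v x) : opD n s (u + v) x = opD n s u x + opD n s v x := by
  unfold opD
  rw [hypLaplacian_add hu hv, Pi.add_apply]
  ring

theorem opD_const_mul {u : Amb n → ℝ} {x : Amb n} (s c : ℝ) (hu : ContDiffAt ℝ 2 u x) :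
    opD n s (fun y => c * u y) x = c * opD n s u x := by
  unfold opD
  rw [hypLaplacian_const_mul c hu]
  ring

theorem contDiffOn_laplacian {u : Amb n → ℝ} {Ω : Set (Amb n)} (hΩ : IsOpen Ω)
    {m k : WithTop ℕ∞} (hu : ContDiffOn ℝ k u Ω) (hmk : m + 2 ≤ k) :
    ContDiffOn ℝ m (Laplacian.laplacian u) Ω := by
  have h1 : ContDiffOn ℝ (m + 1) (fderiv ℝ u) Ω :=
    hu.fderiv_of_isOpen hΩ (by rw [add_assoc]; exact hmk)
  have h2 : ContDiffOn ℝ m (fderiv ℝ (fderiv ℝ u)) Ω := h1.fderiv_of_isOpen hΩ le_rfl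
  have : Laplacian.laplacian u =
      fun x => ∑ i, fderiv ℝ (fderiv ℝ u) x (stdBasis n i) (stdBasis n i) := by
    ext x; exact laplacian_apply u x
  rw [this]
  exact ContDiffOn.sum fun i _ => (h2.clm_apply contDiffOn_const).clm_apply contDiffOn_const

theorem contDiffOn_hypLaplacian {u : Amb n → ℝ} {Ω : Set (Amb n)} (hΩ : IsOpen Ω)
    {m k : WithTop ℕ∞} (hu : ContDiffOn ℝ k u Ω) (hmk : m + 2 ≤ k) :
    ContDiffOn ℝ m (hypLaplacian n u) Ω := by
  have hy : ContDiffOn ℝ m (fun x : Amb n => 1 - ‖x‖ ^ 2) Ω :=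
    (contDiff_const.sub (contDiff_norm_sq ℝ)).contDiffOn
  have h1 : ContDiffOn ℝ m (fderiv ℝ u) Ω :=
    hu.fderiv_of_isOpen hΩ (le_trans (by gcongr; norm_num) hmk)
  exact (hy.div_const 4).mul ((hy.mul (contDiffOn_laplacian hΩ hu hmk)).add
    (contDiffOn_const.mul (h1.clm_apply contDiffOn_id)))

theorem contDiffOn_opD {u : Amb n → ℝ} {Ω : Set (Amb n)} (hΩ : IsOpen Ω) (s : ℝ)
    {m k : WithTop ℕ∞} (hu : ContDiffOn ℝ k u Ω) (hmk : m + 2 ≤ k) :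
    ContDiffOn ℝ m (opD n s u) Ω :=
  (contDiffOn_hypLaplacian hΩ hu hmk).neg.sub
    (contDiffOn_const.mul (hu.of_le (le_trans le_self_add hmk)))

/-! ### Products of the operators `D_{s - 2l}` -/

theorem opD_add_const_mul {u v : Amb n → ℝ} {x : Amb n} (s c : ℝ) (hu : ContDiffAt ℝ 2 u x)
    (hv : ContDiffAt ℝ 2 v x) :
    opD n s (fun y => u y + c * v y) x = opD n s u x + c * opD n s v x := by
  have h := opD_add s hu (contDiffAt_const.mul hv : ContDiffAt ℝ 2 (fun y => c * v y) x)
  rw [opD_const_mul s c hv] at h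
  exact h

/-- All these operators are `-Δ₊` plus a constant, hence polynomials in one operator; four
derivatives make `Δ₊ (Δ₊ u)` meaningful. -/
theorem opD_comm {u : Amb n → ℝ} {Ω : Set (Amb n)} (hΩ : IsOpen Ω) (hu : ContDiffOn ℝ 4 u Ω)
    (s t : ℝ) : EqOn (opD n s (opD n t u)) (opD n t (opD n s u)) Ω := by
  have hl : ContDiffOn ℝ 2 (hypLaplacian n u) Ω :=
    contDiffOn_hypLaplacian hΩ hu (by norm_num)
  have key : ∀ a b : ℝ, ∀ x ∈ Ω, opD n a (opD n b u) x =
      hypLaplacian n (hypLaplacian n u) x + (a * (n - a) + b * (n - b)) * hypLaplacian n u x +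
        a * (n - a) * (b * (n - b)) * u x := by
    intro a b x hx
    have hlx := hl.contDiffAt (hΩ.mem_nhds hx)
    have hux : ContDiffAt ℝ 2 u x := (hu.contDiffAt (hΩ.mem_nhds hx)).of_le (by norm_num)
    have e : opD n b u = fun y => (-1 : ℝ) * hypLaplacian n u y + -(b * (n - b)) * u y := by
      ext y; unfold opD; ring
    have h1 := hypLaplacian_add (n := n) (x := x)
      (contDiffAt_const.mul hlx : ContDiffAt ℝ 2 (fun y => (-1 : ℝ) * hypLaplacian n u y) x)
      (contDiffAt_const.mul hux : ContDiffAt ℝ 2 (fun y => -(b * (n - b)) * u y) x)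
    rw [hypLaplacian_const_mul _ hlx, hypLaplacian_const_mul _ hux] at h1
    have h2 : hypLaplacian n (opD n b u) x =
        -1 * hypLaplacian n (hypLaplacian n u) x + -(b * (n - b)) * hypLaplacian n u x := by
      rw [e]; exact h1
    unfold opD at h2 ⊢
    rw [h2]
    ring
  intro x hx
  rw [key s t x hx, key t s x hx]
  ring

theorem prodD_cons (γ : ℝ) (l : ℕ) (L : List ℕ) (u : Amb n → ℝ) :
    prodD n γ (l :: L) u = opD n ((n : ℝ) / 2 + γ - 2 * l) (prodD n γ L u) := rfl

theorem prodD_append (γ : ℝ) (L L' : List ℕ) (u : Amb n → ℝ) :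
    prodD n γ (L ++ L') u = prodD n γ L (prodD n γ L' u) := by
  simp [prodD]

theorem prodD_congr (γ : ℝ) (L : List ℕ) {u v : Amb n → ℝ} {Ω : Set (Amb n)} (hΩ : IsOpen Ω)
    (h : EqOn u v Ω) : EqOn (prodD n γ L u) (prodD n γ L v) Ω := by
  induction L with
  | nil => exact h
  | cons l L ih => exact fun x hx => opD_congr _ (ih.eventuallyEq_of_mem (hΩ.mem_nhds hx))

theorem contDiffOn_prodD (γ : ℝ) (L : List ℕ) {u : Amb n → ℝ} {Ω : Set (Amb n)} (hΩ : IsOpen Ω)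
    {m : ℕ} (hu : ContDiffOn ℝ ((m + 2 * L.length : ℕ) : WithTop ℕ∞) u Ω) :
    ContDiffOn ℝ m (prodD n γ L u) Ω := by
  induction L generalizing m with
  | nil => exact (by simpa using hu : ContDiffOn ℝ m u Ω)
  | cons l L ih =>
    refine contDiffOn_opD (k := ((m + 2 : ℕ) : WithTop ℕ∞)) hΩ _ (ih ?_) (by push_cast; rfl)
    convert hu using 2
    simp only [List.length_cons]
    ring

theorem prodD_add_const_mul (γ : ℝ) (L : List ℕ) {u v : Amb n → ℝ} {Ω : Set (Amb n)}
    (hΩ : IsOpen Ω) (c : ℝ) (hu : ContDiffOn ℝ ((2 * L.length : ℕ) : WithTop ℕ∞) u Ω)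
    (hv : ContDiffOn ℝ ((2 * L.length : ℕ) : WithTop ℕ∞) v Ω) :
    EqOn (prodD n γ L (fun x => u x + c * v x))
      (fun x => prodD n γ L u x + c * prodD n γ L v x) Ω := by
  induction L with
  | nil => exact fun x _ => rfl
  | cons l L ih =>
    intro x hx
    have hle : ((2 * L.length : ℕ) : WithTop ℕ∞) ≤ ((2 * (l :: L).length : ℕ) : WithTop ℕ∞) := by
      exact_mod_cast (by simp : 2 * L.length ≤ 2 * (l :: L).length)
    have e := ih (hu.of_le hle) (hv.of_le hle)
    have h2 : ∀ {w : Amb n → ℝ}, ContDiffOn ℝ ((2 * (l :: L).length : ℕ) : WithTop ℕ∞) w Ω →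
        ContDiffAt ℝ 2 (prodD n γ L w) x := fun hw =>
      (contDiffOn_prodD (m := 2) γ L hΩ (by
        convert hw using 2
        simp only [List.length_cons]
        ring)).contDiffAt (hΩ.mem_nhds hx)
    rw [prodD_cons, opD_congr _ (e.eventuallyEq_of_mem (hΩ.mem_nhds hx)),
      opD_add_const_mul _ _ (h2 hu) (h2 hv)]
    rfl

theorem prodD_perm (γ : ℝ) {L L' : List ℕ} (h : L.Perm L') {u : Amb n → ℝ} {Ω : Set (Amb n)}
    (hΩ : IsOpen Ω) (hu : ContDiffOn ℝ ((2 * L.length : ℕ) : WithTop ℕ∞) u Ω) :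
    EqOn (prodD n γ L u) (prodD n γ L' u) Ω := by
  induction h with
  | nil => exact fun x _ => rfl
  | cons l h ih =>
    intro x hx
    refine opD_congr _ ((ih (hu.of_le ?_)).eventuallyEq_of_mem (hΩ.mem_nhds hx))
    exact_mod_cast (by simp)
  | swap l m L =>
    refine opD_comm hΩ (contDiffOn_prodD (m := 4) γ L hΩ ?_) _ _
    convert hu using 2
    simp only [List.length_cons]
    ring
  | trans h1 h2 ih1 ih2 =>
    exact (ih1 hu).trans (ih2 (by rwa [← h1.length_eq]))

/-! ### The maximum principle -/

/-- A negative second derivative would make `a` a local maximum as well, so `f` would be locally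
constant and its second derivative zero. -/
theorem deriv_deriv_nonneg_of_isLocalMin {f : ℝ → ℝ} {a : ℝ} (h : IsLocalMin f a)
    (hc : ContinuousAt f a) : 0 ≤ deriv (deriv f) a := by
  by_contra hneg
  have hmax := isLocalMax_of_deriv_deriv_neg (not_le.1 hneg) h.deriv_eq_zero hc
  have e : f =ᶠ[𝓝 a] fun _ => f a := by
    filter_upwards [h, hmax] with y h1 h2 using le_antisymm h2 h1
  have e2 : deriv f =ᶠ[𝓝 a] fun _ => (0 : ℝ) := by
    simpa using e.deriv
  rw [e2.deriv_eq] at hneg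
  simp at hneg

theorem fderiv_fderiv_nonneg_of_isLocalMin {f : Amb n → ℝ} {x : Amb n} (h : IsLocalMin f x)
    (hf : ContDiffAt ℝ 2 f x) (v : Amb n) : 0 ≤ fderiv ℝ (fderiv ℝ f) x v v := by
  let p : ℝ → Amb n := fun t => x + t • v
  have hp : ∀ t, HasDerivAt p v t := fun t => by
    simpa [p] using! ((hasDerivAt_id t).smul_const v).const_add x
  have hp0 : p 0 = x := by simp [p]
  have hpt : Tendsto p (𝓝 0) (𝓝 x) := by
    simpa [hp0] using (hp 0).continuousAt.tendsto
  have hmin : IsLocalMin (f ∘ p) 0 := by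
    have h' : IsMinFilter f (𝓝 x) (p 0) := by rw [hp0]; exact h
    exact h'.comp_tendsto hpt
  have hd : deriv (f ∘ p) =ᶠ[𝓝 0] fun t => fderiv ℝ f (p t) v := by
    filter_upwards [hpt.eventually (eventually_differentiableAt hf)] with t ht
    exact (ht.hasFDerivAt.comp_hasDerivAt t (hp t)).deriv
  have hdd : HasDerivAt (fun t => fderiv ℝ f (p t) v) (fderiv ℝ (fderiv ℝ f) x v v) 0 := by
    have h2 := contDiffAt_two_fderiv hf
    rw [← hp0] at h2
    have h3 := (h2.hasFDerivAt.comp_hasDerivAt (0 : ℝ) (hp 0)).clm_apply (hasDerivAt_const 0 v)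
    simpa [hp0] using h3
  rw [← hdd.deriv, ← hd.deriv_eq]
  refine deriv_deriv_nonneg_of_isLocalMin hmin (ContinuousAt.comp ?_ (hp 0).continuousAt)
  rw [hp0]; exact hf.continuousAt

theorem laplacian_nonneg_of_isLocalMin {f : Amb n → ℝ} {x : Amb n} (h : IsLocalMin f x)
    (hf : ContDiffAt ℝ 2 f x) : 0 ≤ Laplacian.laplacian f x := by
  rw [laplacian_apply]
  exact Finset.sum_nonneg fun i _ => fderiv_fderiv_nonneg_of_isLocalMin h hf _

theorem hypLaplacian_nonneg_of_isLocalMin {f : Amb n → ℝ} {x : Amb n} (h : IsLocalMin f x)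
    (hf : ContDiffAt ℝ 2 f x) : 0 ≤ hypLaplacian n f x := by
  have h1 := laplacian_nonneg_of_isLocalMin h hf
  have h2 : hypLaplacian n f x = (1 - ‖x‖ ^ 2) ^ 2 / 4 * Laplacian.laplacian f x := by
    unfold hypLaplacian
    rw [h.fderiv_eq_zero]
    simp
    ring
  rw [h2]
  positivity

/-- If `φ` is a positive strict supersolution and `v` a solution with `v / φ → 0` at the boundary,
then `v ≤ 0`. -/
theorem nonpos_of_supersolution {s : ℝ} {v φ : Amb n → ℝ} (hv : ContDiffOn ℝ 2 v (openBall n))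
    (hφ : ContDiffOn ℝ 2 φ (openBall n)) (hφ0 : ∀ x ∈ openBall n, 0 < φ x)
    (hDφ : ∀ x ∈ openBall n, 0 < opD n s φ x) (hDv : ∀ x ∈ openBall n, opD n s v x = 0)
    (hlim : ∀ ξ : Sph n, Tendsto (fun x => v x / φ x) (𝓝[openBall n] (ξ : Amb n)) (𝓝 0)) :
    ∀ x ∈ openBall n, v x ≤ 0 := by
  classical
  by_contra! hcon
  obtain ⟨x₁, hx₁, hv₁⟩ := hcon
  -- Extended by zero to the sphere, the quotient is continuous on a compact set, so a positive
  -- maximum exists and is attained inside.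
  set h : Amb n → ℝ := fun x => if x ∈ openBall n then v x / φ x else 0 with hh
  have hB : IsOpen (openBall n) := isOpen_ball
  have hcont : ContinuousOn h (closedBall 0 1) := by
    intro x hx
    by_cases hxb : x ∈ openBall n
    · have : h =ᶠ[𝓝 x] fun x => v x / φ x := by
        filter_upwards [hB.mem_nhds hxb] with y hy
        simp only [hh, if_pos hy]
      exact (((hv.contDiffAt (hB.mem_nhds hxb)).continuousAt.div
        (hφ.contDiffAt (hB.mem_nhds hxb)).continuousAt (hφ0 x hxb).ne').congr
          this.symm).continuousWithinAt
    · have hxs : x ∈ sphere (0 : Amb n) 1 := by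
        rw [mem_closedBall] at hx
        rw [mem_ball] at hxb
        exact le_antisymm hx (not_lt.1 hxb)
      have h0 : h x = 0 := by simp only [hh, if_neg hxb]
      rw [ContinuousWithinAt, h0, ← ball_union_sphere, nhdsWithin_union, tendsto_sup]
      constructor
      · refine (hlim ⟨x, hxs⟩).congr' ?_
        filter_upwards [self_mem_nhdsWithin] with y hy
        have hy' : y ∈ openBall n := hy
        simp only [hh, if_pos hy']
      · refine tendsto_const_nhds.congr' ?_
        filter_upwards [self_mem_nhdsWithin] with y hy
        have hy' : y ∉ openBall n := by
          rw [mem_sphere] at hy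
          simp only [mem_ball, hy, lt_irrefl, not_false_eq_true]
        simp only [hh, if_neg hy']
  obtain ⟨x₀, hx₀, hmax⟩ := (isCompact_closedBall (0 : Amb n) 1).exists_isMaxOn
    ⟨x₁, ball_subset_closedBall hx₁⟩ hcont
  have hpos : 0 < h x₀ := by
    refine lt_of_lt_of_le ?_ (hmax (ball_subset_closedBall hx₁))
    simp only [hh, if_pos hx₁]
    exact div_pos hv₁ (hφ0 x₁ hx₁)
  have hx₀b : x₀ ∈ openBall n := by
    by_contra hcon
    simp only [hh, if_neg hcon, lt_irrefl] at hpos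
  set K := h x₀
  have hK : K = v x₀ / φ x₀ := by simp only [K, hh, if_pos hx₀b]
  -- The zero-order coefficient of `D` may have either sign, so the maximum principle is applied to
  -- this difference: it is nonpositive and touches zero at `x₀`, where the zero-order term drops
  -- out.
  let m : Amb n → ℝ := fun x => v x + -K * φ x
  have hm0 : m x₀ = 0 := by
    simp only [m, hK]
    have := (hφ0 x₀ hx₀b).ne'
    field_simp
    ring
  have hmle : ∀ x ∈ openBall n, m x ≤ 0 := by
    intro x hx
    have h1 : h x ≤ K := hmax (ball_subset_closedBall hx)
    simp only [hh, if_pos hx] at h1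
    rw [div_le_iff₀ (hφ0 x hx)] at h1
    simp only [m]
    linarith
  have hmC : ContDiffAt ℝ 2 m x₀ :=
    (hv.contDiffAt (hB.mem_nhds hx₀b)).add (contDiffAt_const.mul (hφ.contDiffAt (hB.mem_nhds hx₀b)))
  have hloc : IsLocalMin (fun x => -m x) x₀ := by
    filter_upwards [hB.mem_nhds hx₀b] with y hy
    have := hmle y hy
    simp only [hm0]
    linarith
  have hL := hypLaplacian_nonneg_of_isLocalMin hloc hmC.neg
  have hD := opD_add_const_mul s (-K) (hv.contDiffAt (hB.mem_nhds hx₀b))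
    (hφ.contDiffAt (hB.mem_nhds hx₀b))
  rw [hDv x₀ hx₀b] at hD
  have hneg : hypLaplacian n (fun x => -m x) x₀ = -hypLaplacian n m x₀ := by
    have := hypLaplacian_const_mul (-1) hmC
    simpa using this
  have hD' : opD n s m x₀ = -hypLaplacian n m x₀ := by
    unfold opD; rw [hm0]; ring
  have : opD n s m x₀ < 0 := by
    have h3 := mul_pos hpos (hDφ x₀ hx₀b)
    have h4 : opD n s m x₀ = 0 + -K * opD n s φ x₀ := hD
    rw [h4]
    linarith
  linarith

theorem eq_zero_of_supersolution {s : ℝ} {v φ : Amb n → ℝ} (hv : ContDiffOn ℝ 2 v (openBall n))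
    (hφ : ContDiffOn ℝ 2 φ (openBall n)) (hφ0 : ∀ x ∈ openBall n, 0 < φ x)
    (hDφ : ∀ x ∈ openBall n, 0 < opD n s φ x) (hDv : ∀ x ∈ openBall n, opD n s v x = 0)
    (hlim : ∀ ξ : Sph n, Tendsto (fun x => v x / φ x) (𝓝[openBall n] (ξ : Amb n)) (𝓝 0)) :
    ∀ x ∈ openBall n, v x = 0 := by
  intro x hx
  refine le_antisymm (nonpos_of_supersolution hv hφ hφ0 hDφ hDv hlim x hx) ?_
  have h := nonpos_of_supersolution (v := fun x => -1 * v x) (contDiffOn_const.mul hv) hφ hφ0 hDφ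
    (fun y hy => by
      rw [opD_const_mul _ _ (hv.contDiffAt (isOpen_ball.mem_nhds hy)), hDv y hy, mul_zero])
    (fun ξ => by simpa [neg_div] using (hlim ξ).const_mul (-1)) x hx
  linarith

/-! ### Supersolutions -/

theorem normSq_lt_one {x : Amb n} (hx : x ∈ openBall n) : ‖x‖ ^ 2 < 1 := by
  rw [mem_ball_zero_iff] at hx
  have := norm_nonneg x
  nlinarith

/-- The first coefficient is the indicial polynomial, which vanishes for `a = n/2 ± τ`; the sign of
the second then decides whether the power is a supersolution. -/
theorem opD_one_sub_normSq_rpow (a τ : ℝ) {x : Amb n} (hx : x ∈ openBall n) :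
    opD n ((n : ℝ) / 2 + τ) (fun y => (1 - ‖y‖ ^ 2) ^ a) x =
      (τ ^ 2 - (a - n / 2) ^ 2) * (1 - ‖x‖ ^ 2) ^ a +
        a * (a - (n - 1) / 2) * (1 - ‖x‖ ^ 2) ^ a * (1 - ‖x‖ ^ 2) := by
  have hs := normSq_lt_one hx
  have h1 : ∀ᶠ s in 𝓝 (‖x‖ ^ 2),
      HasDerivAt (fun s : ℝ => (1 - s) ^ a) (-1 * a * (1 - s) ^ (a - 1)) s := by
    filter_upwards [Iio_mem_nhds hs] with s hs
    exact ((hasDerivAt_id' s).const_sub 1).rpow_const (Or.inl (sub_pos.2 hs).ne')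
  have h2 : HasDerivAt (fun s : ℝ => -1 * a * (1 - s) ^ (a - 1))
      (-1 * a * (-1 * (a - 1) * (1 - ‖x‖ ^ 2) ^ (a - 1 - 1))) (‖x‖ ^ 2) :=
    (((hasDerivAt_id' (‖x‖ ^ 2)).const_sub 1).rpow_const
      (Or.inl (sub_pos.2 hs).ne')).const_mul _
  have hy : 0 < 1 - ‖x‖ ^ 2 := sub_pos.2 hs
  unfold opD
  rw [hypLaplacian_radial h1 h2]
  simp only [Real.rpow_sub_one hy.ne']
  field_simp
  ring

/-- For positive `a` the correction `a (a + 1)` is always positive, whereas `a (a - (n-1)/2)` for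
the plain power of `1 - ‖x‖ ^ 2` may be negative. -/
theorem opD_klein_rpow (a τ : ℝ) {x : Amb n} (hx : x ∈ openBall n) :
    opD n ((n : ℝ) / 2 + τ) (fun y => ((1 - ‖y‖ ^ 2) / (1 + ‖y‖ ^ 2)) ^ a) x =
      (τ ^ 2 - (a - n / 2) ^ 2) * ((1 - ‖x‖ ^ 2) / (1 + ‖x‖ ^ 2)) ^ a +
        a * (a + 1) * ((1 - ‖x‖ ^ 2) / (1 + ‖x‖ ^ 2)) ^ a *
          ((1 - ‖x‖ ^ 2) / (1 + ‖x‖ ^ 2)) ^ 2 := by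
  have hs := normSq_lt_one hx
  have hs0 : -1 < ‖x‖ ^ 2 := lt_of_lt_of_le (by norm_num) (sq_nonneg ‖x‖)
  have hQ : ∀ s : ℝ, -1 < s →
      HasDerivAt (fun s : ℝ => (1 - s) / (1 + s)) (-2 / (1 + s) ^ 2) s := by
    intro s h
    have h0 : (1 + s) ≠ 0 := by linarith
    refine (((hasDerivAt_id' s).const_sub 1).div ((hasDerivAt_id' s).const_add 1) h0).congr_deriv ?_
    field_simp
    ring
  have hpos : ∀ s : ℝ, s ∈ Ioo (-1 : ℝ) 1 → 0 < (1 - s) / (1 + s) := by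
    intro s h
    exact div_pos (by linarith [h.2]) (by linarith [h.1])
  have h1 : ∀ᶠ s in 𝓝 (‖x‖ ^ 2), HasDerivAt (fun s : ℝ => ((1 - s) / (1 + s)) ^ a)
      (-2 / (1 + s) ^ 2 * a * ((1 - s) / (1 + s)) ^ (a - 1)) s := by
    filter_upwards [Ioo_mem_nhds hs0 hs] with s hs
    exact (hQ s hs.1).rpow_const (Or.inl (hpos s hs).ne')
  have hR : HasDerivAt (fun s : ℝ => -2 / (1 + s) ^ 2) (4 / (1 + ‖x‖ ^ 2) ^ 3) (‖x‖ ^ 2) := by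
    have h0 : (1 + ‖x‖ ^ 2) ≠ 0 := by linarith
    refine ((hasDerivAt_const _ (-2 : ℝ)).div (((hasDerivAt_id' (‖x‖ ^ 2)).const_add 1).pow 2)
      (pow_ne_zero 2 h0)).congr_deriv ?_
    simp only [Pi.pow_apply]
    field_simp
    norm_num
    ring
  have h2 := (hR.mul_const a).mul ((hQ _ hs0).rpow_const (p := a - 1)
    (Or.inl (hpos _ ⟨hs0, hs⟩).ne'))
  have hy : 0 < 1 - ‖x‖ ^ 2 := sub_pos.2 hs
  have hz : 0 < 1 + ‖x‖ ^ 2 := by positivity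
  have hq := hpos _ ⟨hs0, hs⟩
  unfold opD
  rw [hypLaplacian_radial h1 h2]
  simp only [Real.rpow_sub_one hq.ne']
  generalize ((1 - ‖x‖ ^ 2) / (1 + ‖x‖ ^ 2)) ^ a = W
  field_simp
  ring

theorem rho_pos {x : Amb n} (hx : x ∈ openBall n) : 0 < rho x := by
  rw [mem_ball_zero_iff] at hx
  have := norm_nonneg x
  exact div_pos (by linarith) (by linarith)

theorem norm_sphere (ξ : Sph n) : ‖(ξ : Amb n)‖ = 1 := mem_sphere_zero_iff_norm.1 ξ.2

/-- A boundary limit with respect to `rho` is one with respect to any comparable weight. -/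
theorem tendsto_div_rpow {a : ℝ} {v p : Amb n → ℝ} {κ : ℝ → ℝ} (hκ : ContinuousAt κ 1)
    (hκ0 : 0 < κ 1) (hp : ∀ x ∈ openBall n, 0 < p x)
    (hκp : ∀ x ∈ openBall n, rho x = κ ‖x‖ * p x) {ξ : Sph n}
    (hlim : Tendsto (fun x => rho x ^ (-a) * v x) (𝓝[openBall n] (ξ : Amb n)) (𝓝 0)) :
    Tendsto (fun x => v x / p x ^ a) (𝓝[openBall n] (ξ : Amb n)) (𝓝 0) := by
  have hk : Tendsto (fun x : Amb n => κ ‖x‖ ^ a) (𝓝[openBall n] (ξ : Amb n)) (𝓝 (κ 1 ^ a)) := by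
    have h1 : Tendsto (fun x : Amb n => ‖x‖) (𝓝[openBall n] (ξ : Amb n)) (𝓝 1) := by
      have := (continuous_norm.tendsto (ξ : Amb n)).mono_left
        (nhdsWithin_le_nhds (s := openBall n))
      rwa [norm_sphere] at this
    exact (hκ.tendsto.comp h1).rpow_const (Or.inl hκ0.ne')
  have h := hlim.mul hk
  rw [zero_mul] at h
  refine h.congr' ?_
  filter_upwards [self_mem_nhdsWithin] with x hx
  have h1 := hκp x hx
  have h2 := rho_pos hx
  have h3 := hp x hx
  have h4 : 0 < κ ‖x‖ := by
    rw [h1] at h2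
    exact pos_of_mul_pos_left h2 h3.le
  rw [h1, Real.mul_rpow h4.le h3.le, Real.rpow_neg h4.le, Real.rpow_neg h3.le]
  have := (Real.rpow_pos_of_pos h4 a).ne'
  field_simp

/-- Uniqueness for the equation `D_{n/2 + τ} v = 0`: a solution that is small compared with the
leading power `rho ^ (n/2 - |τ|)` vanishes. -/
theorem eq_zero_of_opD_eq_zero (hn : 1 ≤ n) {τ : ℝ} (hτ : τ ≠ 0) {v : Amb n → ℝ}
    (hv : ContDiffOn ℝ 2 v (openBall n))
    (hDv : ∀ x ∈ openBall n, opD n ((n : ℝ) / 2 + τ) v x = 0)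
    (hlim : ∀ ξ : Sph n, Tendsto (fun x => rho x ^ (-((n : ℝ) / 2 - |τ|)) * v x)
      (𝓝[openBall n] (ξ : Amb n)) (𝓝 0)) :
    ∀ x ∈ openBall n, v x = 0 := by
  have hn' : (1 : ℝ) ≤ n := by exact_mod_cast hn
  have hτ2 : 0 < τ ^ 2 := by positivity
  set a := (n : ℝ) / 2 - |τ| with ha
  have hsq : τ ^ 2 - (a - n / 2) ^ 2 = 0 := by
    rw [ha, ← sq_abs τ]; ring
  have hy : ∀ x ∈ openBall n, 0 < 1 - ‖x‖ ^ 2 := fun x hx => sub_pos.2 (normSq_lt_one hx)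
  have hyC : ContDiff ℝ 2 (fun x : Amb n => 1 - ‖x‖ ^ 2) := contDiff_const.sub (contDiff_norm_sq ℝ)
  rcases lt_or_ge 0 a with h0 | h0
  · have hQ : ∀ x ∈ openBall n, 0 < (1 - ‖x‖ ^ 2) / (1 + ‖x‖ ^ 2) := fun x hx =>
      div_pos (hy x hx) (by positivity)
    refine eq_zero_of_supersolution (φ := fun x => ((1 - ‖x‖ ^ 2) / (1 + ‖x‖ ^ 2)) ^ a) hv ?_
      (fun x hx => Real.rpow_pos_of_pos (hQ x hx) a) (fun x hx => ?_) hDv fun ξ => ?_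
    · intro x hx
      exact ((hyC.contDiffAt.div (contDiff_const.add (contDiff_norm_sq ℝ)).contDiffAt
        (by positivity)).rpow_const_of_ne (hQ x hx).ne').contDiffWithinAt
    · rw [opD_klein_rpow a τ hx, hsq, zero_mul, zero_add]
      have := Real.rpow_pos_of_pos (hQ x hx) a
      have := hQ x hx
      positivity
    · refine tendsto_div_rpow (κ := fun r => 2 * (1 + r ^ 2) / (1 + r) ^ 2) ?_ (by norm_num) hQ
        (fun x hx => ?_) (hlim ξ)
      · exact ContinuousAt.div (by fun_prop) (by fun_prop) (by norm_num)
      · have := norm_nonneg x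
        have h1 : 1 + ‖x‖ ≠ 0 := by positivity
        have h2 : 1 + ‖x‖ ^ 2 ≠ 0 := by positivity
        unfold rho
        field_simp
        ring
  · have hp1 : ∀ x ∈ openBall n, 0 < (1 - ‖x‖ ^ 2) ^ a := fun x hx =>
      Real.rpow_pos_of_pos (hy x hx) a
    have hp2 : ∀ x ∈ openBall n, 0 < (1 - ‖x‖ ^ 2) ^ ((n : ℝ) / 2) := fun x hx =>
      Real.rpow_pos_of_pos (hy x hx) _
    have hC : ∀ b : ℝ, ContDiffOn ℝ 2 (fun x : Amb n => (1 - ‖x‖ ^ 2) ^ b) (openBall n) :=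
      fun b x hx => (hyC.contDiffAt.rpow_const_of_ne (hy x hx).ne').contDiffWithinAt
    -- For `a ≤ 0` the correction of the first power is nonnegative but may vanish, as at `a = 0`.
    -- The second power restores strictness: its indicial coefficient is `τ ^ 2 > 0`.
    refine eq_zero_of_supersolution
      (φ := fun x => (1 - ‖x‖ ^ 2) ^ a + 1 * (1 - ‖x‖ ^ 2) ^ ((n : ℝ) / 2)) hv
      ((hC a).add (contDiffOn_const.mul (hC _))) (fun x hx => ?_) (fun x hx => ?_) hDv fun ξ => ?_
    · linarith [hp1 x hx, hp2 x hx]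
    · rw [opD_add_const_mul _ _ ((hC a).contDiffAt (isOpen_ball.mem_nhds hx))
        ((hC _).contDiffAt (isOpen_ball.mem_nhds hx)), opD_one_sub_normSq_rpow a τ hx,
        opD_one_sub_normSq_rpow _ τ hx, hsq, zero_mul, zero_add]
      have h1 : 0 ≤ a * (a - (n - 1) / 2) := mul_nonneg_of_nonpos_of_nonpos h0 (by linarith)
      have h2 := mul_nonneg (mul_nonneg h1 (hp1 x hx).le) (hy x hx).le
      have h3 := mul_pos hτ2 (hp2 x hx)
      have h4 := mul_pos (mul_pos (by linarith : (0 : ℝ) < n / 4) (hp2 x hx)) (hy x hx)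
      nlinarith
    · have h1 := tendsto_div_rpow (κ := fun r => 2 / (1 + r) ^ 2) (a := a)
        (ContinuousAt.div (by fun_prop) (by fun_prop) (by norm_num)) (by norm_num) hy
        (fun x hx => by
          have := norm_nonneg x
          have h1 : 1 + ‖x‖ ≠ 0 := by positivity
          unfold rho
          field_simp
          ring) (hlim ξ)
      refine squeeze_zero_norm' ?_ (tendsto_zero_iff_norm_tendsto_zero.1 h1)
      filter_upwards [self_mem_nhdsWithin] with x hx
      have h2 := hp1 x hx
      have h3 := hp2 x hx
      have h4 : (1 - ‖x‖ ^ 2) ^ a ≤ (1 - ‖x‖ ^ 2) ^ a + 1 * (1 - ‖x‖ ^ 2) ^ ((n : ℝ) / 2) := by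
        linarith
      rw [norm_div, norm_div, Real.norm_of_nonneg h2.le, Real.norm_of_nonneg (h2.le.trans h4)]
      exact div_le_div_of_nonneg_left (norm_nonneg _) h2 h4

/-! ### Uniqueness for the Dirichlet problem -/

theorem fract_eq_sub_natFloor {γ : ℝ} (hγ : 0 < γ) : Int.fract γ = γ - ⌊γ⌋₊ := by
  rw [natCast_floor_eq_intCast_floor hγ.le]
  rfl

theorem floor_half (γ : ℝ) : ⌊γ / 2⌋₊ = ⌊γ⌋₊ / 2 := Nat.floor_div_ofNat γ 2

/-- The factors of the boundary operator `B_{2j}` of small index. -/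
abbrev evenLowList (γ : ℝ) (j : ℕ) : List ℕ :=
  List.range j ++ List.Ico (⌊γ⌋₊ - j + 1) (⌊γ⌋₊ + 1)

/-- The factors of the boundary operator `B_{2j + 2[γ]}` of small index. -/
abbrev fracLowList (γ : ℝ) (j : ℕ) : List ℕ :=
  List.range (j + 1) ++ List.Ico (⌊γ⌋₊ - j + 1) (⌊γ⌋₊ + 1)

/-- Together with `evenLowList_succ_perm` this is the chain of lists along which factors are removed
one at a time. -/
theorem fracLowList_perm (γ : ℝ) (j : ℕ) : (j :: evenLowList γ j).Perm (fracLowList γ j) := by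
  simp only [fracLowList, List.range_succ, List.append_assoc, List.singleton_append]
  exact List.perm_middle.symm

theorem evenLowList_succ_perm (γ : ℝ) {j : ℕ} (hj : j + 1 ≤ ⌊γ⌋₊) :
    ((⌊γ⌋₊ - j) :: fracLowList γ j).Perm (evenLowList γ (j + 1)) := by
  have h : ⌊γ⌋₊ - (j + 1) + 1 = ⌊γ⌋₊ - j := by omega
  simp only [evenLowList, fracLowList, h]
  rw [List.Ico.eq_cons (by omega : ⌊γ⌋₊ - j < ⌊γ⌋₊ + 1)]
  exact List.perm_middle.symm

theorem length_evenLowList (γ : ℝ) {j : ℕ} (hj : j ≤ ⌊γ⌋₊) : (evenLowList γ j).length = 2 * j := by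
  simp
  omega

theorem length_fracLowList (γ : ℝ) {j : ℕ} (hj : j ≤ ⌊γ⌋₊) :
    (fracLowList γ j).length = 2 * j + 1 := by
  simp
  omega

theorem prodD_eq_zero_of_cons (hn : 1 ≤ n) {γ : ℝ} {L L' : List ℕ} {l N : ℕ}
    (hp : (l :: L).Perm L') (hlen : L.length + 1 ≤ N) (hl : γ - 2 * l ≠ 0) {w : Amb n → ℝ}
    (hw : ContDiffOn ℝ ((2 * N : ℕ) : WithTop ℕ∞) w (openBall n))
    (h0 : ∀ x ∈ openBall n, prodD n γ L' w x = 0)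
    (hlim : ∀ ξ : Sph n, Tendsto (fun x => rho x ^ (-((n : ℝ) / 2 - |γ - 2 * l|)) * prodD n γ L w x)
      (𝓝[openBall n] (ξ : Amb n)) (𝓝 0)) :
    ∀ x ∈ openBall n, prodD n γ L w x = 0 := by
  have hw' : ContDiffOn ℝ ((2 * (l :: L).length : ℕ) : WithTop ℕ∞) w (openBall n) := by
    refine hw.of_le ?_
    have : 2 * (l :: L).length ≤ 2 * N := by simp only [List.length_cons]; omega
    exact_mod_cast this
  refine eq_zero_of_opD_eq_zero hn hl (contDiffOn_prodD (m := 2) γ L isOpen_ball ?_)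
    (fun x hx => ?_) hlim
  · convert hw' using 2
    simp only [List.length_cons]
    ring
  · rw [← h0 x hx, ← prodD_perm γ hp isOpen_ball hw' hx, prodD_cons, add_sub_assoc]

/-- A solution of `∏ D_{s - 2l} w = 0` all of whose boundary values of small index vanish is zero. -/
theorem eq_zero_of_boundary_values (hn : 1 ≤ n) {γ : ℝ} (hγ : 0 < γ) (hγN : ∀ m : ℕ, γ ≠ m)
    {w : Amb n → ℝ}
    (hw : ContDiffOn ℝ ((2 * (⌊γ⌋₊ + 1) : ℕ) : WithTop ℕ∞) w (openBall n))
    (h0 : ∀ x ∈ openBall n, prodD n γ (List.range (⌊γ⌋₊ + 1)) w x = 0)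
    (hE : ∀ j : ℕ, j ≤ ⌊γ / 2⌋₊ → ∀ ξ : Sph n,
      Tendsto (fun x => rho x ^ (-(n : ℝ) / 2 + γ - 2 * (j : ℝ)) * prodD n γ (evenLowList γ j) w x)
        (𝓝[openBall n] (ξ : Amb n)) (𝓝 0))
    (hF : ∀ j : ℕ, j < ⌊γ⌋₊ - ⌊γ / 2⌋₊ → ∀ ξ : Sph n,
      Tendsto (fun x => rho x ^ (-(n : ℝ) / 2 + γ - 2 * (j : ℝ) - 2 * Int.fract γ) *
        prodD n γ (fracLowList γ j) w x) (𝓝[openBall n] (ξ : Amb n)) (𝓝 0)) :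
    ∀ x ∈ openBall n, w x = 0 := by
  rw [floor_half] at hE hF
  have hfl : (⌊γ⌋₊ : ℝ) < γ := lt_of_le_of_ne (Nat.floor_le hγ.le) (hγN _).symm
  have hfu : γ < ⌊γ⌋₊ + 1 := Nat.lt_floor_add_one γ
  -- Here `τ = γ - 2j > 0`, so `n/2 - |τ|` is the exponent in the definition of `B_{2j}`. In
  -- `stepF`, `τ = γ - 2(⌊γ⌋ - j) < 0`, and `n/2 - |τ|` is the exponent in that of `B_{2j+2[γ]}`.
  have stepE : ∀ j : ℕ, 2 * j ≤ ⌊γ⌋₊ → (∀ x ∈ openBall n, prodD n γ (fracLowList γ j) w x = 0) →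
      ∀ x ∈ openBall n, prodD n γ (evenLowList γ j) w x = 0 := by
    intro j hj hz
    have hpos : 0 < γ - 2 * (j : ℝ) := by
      have : (2 * j : ℝ) ≤ ⌊γ⌋₊ := by exact_mod_cast hj
      linarith
    refine prodD_eq_zero_of_cons hn (fracLowList_perm γ j)
      (by rw [length_evenLowList γ (by omega)]; omega) hpos.ne' hw hz fun ξ => ?_
    have h := hE j (by omega) ξ
    rw [abs_of_pos hpos]
    convert h using 4
    ring
  have stepF : ∀ j : ℕ, 2 * j + 1 ≤ ⌊γ⌋₊ →
      (∀ x ∈ openBall n, prodD n γ (evenLowList γ (j + 1)) w x = 0) →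
      ∀ x ∈ openBall n, prodD n γ (fracLowList γ j) w x = 0 := by
    intro j hj hz
    have hneg : γ - 2 * ((⌊γ⌋₊ - j : ℕ) : ℝ) < 0 := by
      have : (2 * j + 1 : ℝ) ≤ ⌊γ⌋₊ := by exact_mod_cast hj
      rw [Nat.cast_sub (by omega)]
      linarith
    refine prodD_eq_zero_of_cons hn (evenLowList_succ_perm γ (by omega))
      (by rw [length_fracLowList γ (by omega)]; omega) hneg.ne hw hz fun ξ => ?_
    have h := hF j (by omega) ξ
    rw [abs_of_neg hneg]
    convert h using 4
    rw [Nat.cast_sub (by omega), fract_eq_sub_natFloor hγ]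
    ring
  -- The bound `⌊γ⌋₊ + 1` admits one list beyond those of the boundary operators: the full product
  -- when `⌊γ⌋₊` is odd.
  have desc : ∀ j : ℕ, 2 * j ≤ ⌊γ⌋₊ + 1 → (∀ x ∈ openBall n, prodD n γ (evenLowList γ j) w x = 0) →
      ∀ x ∈ openBall n, w x = 0 := by
    intro j
    induction j with
    | zero =>
      intro _ h x hx
      have := h x hx
      simpa [evenLowList, prodD] using this
    | succ j ih =>
      intro hj h
      exact ih (by omega) (stepE j (by omega) (stepF j (by omega) h))
  have hR : ∀ a b : ℕ, a ≤ b → List.range a ++ List.Ico a b = List.range b := by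
    intro a b hab
    have h : ∀ m, List.range m = List.Ico 0 m := fun m => by simp [List.Ico, List.range_eq_range']
    rw [h, h, List.Ico.append_consecutive (Nat.zero_le _) hab]
  -- The two halves of the list meet exactly at the end of the chain: the full product is
  -- `fracLowList γ m` if `⌊γ⌋₊ = 2m` and `evenLowList γ (m + 1)` if `⌊γ⌋₊ = 2m + 1`.
  rcases Nat.even_or_odd' ⌊γ⌋₊ with ⟨m, hm | hm⟩
  · refine desc m (by omega) (stepE m (by omega) fun x hx => ?_)
    have e : ⌊γ⌋₊ - m + 1 = m + 1 := by omega
    rw [fracLowList, e, hR _ _ (by omega)]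
    exact h0 x hx
  · refine desc (m + 1) (by omega) fun x hx => ?_
    have e : ⌊γ⌋₊ - (m + 1) + 1 = m + 1 := by omega
    rw [evenLowList, e, hR _ _ (by omega)]
    exact h0 x hx

theorem infty_add_two_le : (∞ : WithTop ℕ∞) + 2 ≤ ∞ := by
  change ((⊤ + 2 : ℕ∞) : WithTop ℕ∞) ≤ _
  simp

/-! ### Functions that are smooth and homogeneous of degree zero -/

/-- `h` is smooth away from the origin and homogeneous of degree zero. -/
def IsAngular (h : Amb n → ℝ) : Prop :=
  ContDiffOn ℝ ∞ h {0}ᶜ ∧ ∀ t : ℝ, 0 < t → ∀ x : Amb n, h (t • x) = h x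

theorem IsAngular.contDiffAt {h : Amb n → ℝ} (hh : IsAngular h) {x : Amb n} (hx : x ≠ 0)
    {m : ℕ∞} : ContDiffAt ℝ m h x :=
  (hh.1.contDiffAt (isOpen_compl_singleton.mem_nhds hx)).of_le (by exact_mod_cast le_top)

theorem IsAngular.fderiv_smul {h : Amb n → ℝ} (hh : IsAngular h) {t : ℝ} (ht : 0 < t)
    (x : Amb n) : fderiv ℝ h x = t • fderiv ℝ h (t • x) := by
  have e : (fun y => h (t • y)) = h := funext (hh.2 t ht)
  rw [← fderiv_comp_smul, e]

theorem IsAngular.fderiv_self {h : Amb n → ℝ} (hh : IsAngular h) {x : Amb n} (hx : x ≠ 0) :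
    fderiv ℝ h x x = 0 := by
  have hd : HasFDerivAt h (fderiv ℝ h x) ((1 : ℝ) • x) := by
    rw [one_smul]
    exact ((hh.contDiffAt (m := 1) hx).differentiableAt (by norm_num)).hasFDerivAt
  have h1 : HasDerivAt (fun t : ℝ => h (t • x)) (fderiv ℝ h x x) 1 := by
    have h2 : HasDerivAt (fun t : ℝ => t • x) x 1 := by
      simpa using (hasDerivAt_id (1 : ℝ)).smul_const x
    exact hd.comp_hasDerivAt (1 : ℝ) h2
  have h3 : (fun t : ℝ => h (t • x)) =ᶠ[𝓝 1] fun _ => h x := by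
    filter_upwards [Ioi_mem_nhds (zero_lt_one' ℝ)] with t ht using hh.2 t ht x
  exact h1.unique ((hasDerivAt_const (1 : ℝ) (h x)).congr_of_eventuallyEq h3)

/-- On functions of degree zero `‖x‖² Δ` is the spherical Laplacian; this closure property keeps
`EvenSum` stable under the operators `D`. -/
theorem IsAngular.laplacian {h : Amb n → ℝ} (hh : IsAngular h) :
    IsAngular fun x => ‖x‖ ^ 2 * Laplacian.laplacian h x := by
  refine ⟨((contDiff_norm_sq ℝ).contDiffOn).mul
    (contDiffOn_laplacian isOpen_compl_singleton hh.1 infty_add_two_le), fun t ht x => ?_⟩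
  have e : fderiv ℝ h = fun y => t • fderiv ℝ h (t • y) := funext (hh.fderiv_smul ht)
  have e2 : fderiv ℝ (fderiv ℝ h) x = t • t • fderiv ℝ (fderiv ℝ h) (t • x) := by
    conv_lhs => rw [e]
    let _ := invertibleOfNonzero ht.ne'
    have h1 := fderiv_const_smul_of_invertible (𝕜 := ℝ) (f := fun y => fderiv ℝ h (t • y))
      (x := x) t
    rw [fderiv_comp_smul] at h1
    exact h1
  simp only [laplacian_apply, e2, norm_smul, Real.norm_eq_abs, mul_pow, sq_abs,
    smul_apply, smul_eq_mul, ← Finset.mul_sum]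
  ring

theorem IsAngular.hypLaplacian_eq {h : Amb n → ℝ} (hh : IsAngular h) {x : Amb n} (hx : x ≠ 0) :
    hypLaplacian n h x =
      (1 - ‖x‖ ^ 2) ^ 2 / (4 * ‖x‖ ^ 2) * (‖x‖ ^ 2 * Laplacian.laplacian h x) := by
  have : ‖x‖ ≠ 0 := norm_ne_zero_iff.2 hx
  unfold hypLaplacian
  rw [hh.fderiv_self hx]
  field_simp
  ring

/-- The extension of a function on the sphere that is constant along rays. -/
def angularExt (a : Sph n → ℝ) (x : Amb n) : ℝ :=
  if hx : x ≠ 0 then a ⟨‖x‖⁻¹ • x, by simp [norm_smul, hx]⟩ else 0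

theorem isAngular_angularExt {a : Sph n → ℝ} (ha : ContMDiff (𝓡 n) 𝓘(ℝ, ℝ) ∞ a) :
    IsAngular (angularExt a) := by
  constructor
  · let O : TopologicalSpace.Opens (Amb n) := ⟨{0}ᶜ, isOpen_compl_singleton⟩
    have hO : ∀ x : O, (x : Amb n) ≠ 0 := fun x => x.2
    have hf : ContMDiff 𝓘(ℝ, Amb n) 𝓘(ℝ, Amb n) ∞ (fun x : O => ‖(x : Amb n)‖⁻¹ • (x : Amb n)) := by
      intro x
      refine (contMDiffAt_subtype_iff (f := fun x : Amb n => ‖x‖⁻¹ • x)).2 ?_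
      exact (((contDiffAt_norm ℝ (hO x)).inv (norm_ne_zero_iff.2 (hO x))).smul
        contDiffAt_id).contMDiffAt
    have hs : ∀ x : O, ‖(x : Amb n)‖⁻¹ • (x : Amb n) ∈ sphere (0 : Amb n) 1 := fun x => by
      simp [norm_smul, hO x]
    have hc := ha.comp (hf.codRestrict_sphere hs)
    intro x hx
    have h1 := hc ⟨x, hx⟩
    have e : (a ∘ Set.codRestrict (fun x : O => ‖(x : Amb n)‖⁻¹ • (x : Amb n)) _ hs) =
        fun x : O => angularExt a x := by
      ext y
      simp only [Function.comp_apply, angularExt, dif_pos (hO y)]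
      rfl
    rw [e, contMDiffAt_subtype_iff] at h1
    exact h1.contDiffAt.contDiffWithinAt
  · intro t ht x
    by_cases hx : x = 0
    · simp [hx]
    · have h1 : t • x ≠ 0 := smul_ne_zero ht.ne' hx
      simp only [angularExt, dif_pos hx, dif_pos h1]
      congr 2
      rw [norm_smul, Real.norm_of_nonneg ht.le, smul_smul]
      congr 1
      field_simp

theorem angularExt_smul {a : Sph n → ℝ} {r : ℝ} (hr : 0 < r) (ξ : Sph n) :
    angularExt a (r • (ξ : Amb n)) = a ξ := by
  have hξ := norm_sphere ξ
  have h0 : r • (ξ : Amb n) ≠ 0 := smul_ne_zero hr.ne' (norm_ne_zero_iff.1 (by rw [hξ]; norm_num))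
  simp only [angularExt, dif_pos h0]
  congr 1
  ext1
  simp [norm_smul, hξ, abs_of_pos hr, smul_smul, hr.ne']

/-! ### Conjugation by powers of the defining function -/

/-- The punctured open ball. -/
abbrev punctured (n : ℕ) : Set (Amb n) := openBall n \ {0}

theorem isOpen_punctured : IsOpen (punctured n) := isOpen_ball.sdiff isClosed_singleton

theorem norm_mem_Ioo {x : Amb n} (hx : x ∈ punctured n) : ‖x‖ ∈ Ioo (0 : ℝ) 1 :=
  ⟨norm_pos_iff.2 hx.2, mem_ball_zero_iff.1 hx.1⟩

theorem hasDerivAt_sqrt' {s : ℝ} (hs : 0 < s) : HasDerivAt (fun s => √s) (1 / (2 * √s)) s := by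
  simpa using (hasDerivAt_id' s).sqrt hs.ne'

theorem hasDerivAt_rho_sq {s : ℝ} (hs : 0 < s) :
    HasDerivAt (fun s => 2 * (1 - √s) / (1 + √s)) (-2 / (√s * (1 + √s) ^ 2)) s := by
  have hr := Real.sqrt_pos.2 hs
  refine ((((hasDerivAt_sqrt' hs).const_sub 1).const_mul 2).div
    ((hasDerivAt_sqrt' hs).const_add 1) (by positivity)).congr_deriv ?_
  field_simp
  ring

theorem hasDerivAt_deriv_rho_sq {s : ℝ} (hs : 0 < s) :
    HasDerivAt (fun s => -2 / (√s * (1 + √s) ^ 2))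
      ((1 + 3 * √s) / (√s ^ 3 * (1 + √s) ^ 3)) s := by
  have hr := Real.sqrt_pos.2 hs
  refine ((hasDerivAt_const s (-2 : ℝ)).div ((hasDerivAt_sqrt' hs).mul
    (((hasDerivAt_sqrt' hs).const_add 1).pow 2))
    (show √s * (1 + √s) ^ 2 ≠ 0 by positivity)).congr_deriv ?_
  simp only [Pi.pow_apply, Pi.mul_apply]
  field_simp
  ring

/-- The operator `ρ^{-a} D ρ^a` in terms of the values of `-Δ₊ g`, of `x · ∇g` and of `g`. -/
theorem opD_rho_rpow_mul (a τ : ℝ) {g : Amb n → ℝ} {x : Amb n} (hx : x ∈ punctured n)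
    (hg : ContDiffAt ℝ 2 g x) :
    opD n ((n : ℝ) / 2 + τ) (fun y => rho y ^ a * g y) x =
      rho x ^ a * (-hypLaplacian n g x + a * (1 - ‖x‖ ^ 2) / ‖x‖ * fderiv ℝ g x x +
        (-a ^ 2 + n * a * (1 + ‖x‖ ^ 2) / (2 * ‖x‖) - ((n : ℝ) / 2 + τ) * (n / 2 - τ)) * g x) := by
  obtain ⟨hr0, hr1⟩ := norm_mem_Ioo hx
  have hs0 : 0 < ‖x‖ ^ 2 := by positivity
  have hs1 := normSq_lt_one hx.1
  have hsq : √(‖x‖ ^ 2) = ‖x‖ := Real.sqrt_sq hr0.le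
  have hpos : ∀ s : ℝ, s ∈ Ioo (0 : ℝ) 1 → 0 < 2 * (1 - √s) / (1 + √s) := by
    intro s hs
    have h1 : √s < 1 := by rw [Real.sqrt_lt' one_pos]; simpa using hs.2
    have h2 := Real.sqrt_nonneg s
    exact div_pos (by linarith) (by linarith)
  have h1 : ∀ᶠ s in 𝓝 (‖x‖ ^ 2), HasDerivAt (fun s => (2 * (1 - √s) / (1 + √s)) ^ a)
      (-2 / (√s * (1 + √s) ^ 2) * a * (2 * (1 - √s) / (1 + √s)) ^ (a - 1)) s := by
    filter_upwards [Ioo_mem_nhds hs0 hs1] with s hs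
    exact (hasDerivAt_rho_sq hs.1).rpow_const (Or.inl (hpos s hs).ne')
  have h2 := ((hasDerivAt_deriv_rho_sq hs0).mul_const a).mul
    ((hasDerivAt_rho_sq hs0).rpow_const (p := a - 1) (Or.inl (hpos _ ⟨hs0, hs1⟩).ne'))
  have hF : ContDiffAt ℝ 2 (fun s => (2 * (1 - √s) / (1 + √s)) ^ a) (‖x‖ ^ 2) := by
    have hsC : ContDiffAt ℝ 2 (fun s => √s) (‖x‖ ^ 2) := Real.contDiffAt_sqrt hs0.ne'
    have h0 : 1 + √(‖x‖ ^ 2) ≠ 0 := by positivity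
    exact ((contDiffAt_const.mul (contDiffAt_const.sub hsC)).div (contDiffAt_const.add hsC)
      h0).rpow_const_of_ne (hpos _ ⟨hs0, hs1⟩).ne'
  have key := hypLaplacian_radial_mul hF h1 h2 hg
  have e : (fun y : Amb n => rho y ^ a * g y) =
      fun y => (2 * (1 - √(‖y‖ ^ 2)) / (1 + √(‖y‖ ^ 2))) ^ a * g y := by
    ext y
    rw [Real.sqrt_sq (norm_nonneg y)]
    rfl
  have hρ : 2 * (1 - √(‖x‖ ^ 2)) / (1 + √(‖x‖ ^ 2)) = rho x := by rw [hsq]; rfl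
  unfold opD
  rw [e, key]
  simp only [hρ]
  have hρ0 := rho_pos hx.1
  simp only [Real.rpow_sub_one hρ0.ne', hsq]
  generalize rho x ^ a = W
  unfold rho
  have h3 : 1 - ‖x‖ ≠ 0 := by linarith
  field_simp
  ring

/-- The operator `ρ^{-a} ∘ D_{n/2 + τ} ∘ ρ^a`. -/
def conjD (n : ℕ) (a τ : ℝ) (g : Amb n → ℝ) (x : Amb n) : ℝ :=
  -hypLaplacian n g x + a * (1 - ‖x‖ ^ 2) / ‖x‖ * fderiv ℝ g x x +
    (-a ^ 2 + n * a * (1 + ‖x‖ ^ 2) / (2 * ‖x‖) - ((n : ℝ) / 2 + τ) * (n / 2 - τ)) * g x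

/-! ### Functions that are even in the defining function -/

/-- Finite sums of products `c (ρ² / 4) h` with `c` smooth on `(-1, 1)` and `h` angular. -/
inductive EvenSum : (Amb n → ℝ) → Prop
  | term (c : ℝ → ℝ) (h : Amb n → ℝ) (hc : ContDiffOn ℝ ∞ c (Ioo (-1) 1)) (hh : IsAngular h) :
      EvenSum fun x => c (rho x ^ 2 / 4) * h x
  | add (G H : Amb n → ℝ) (hG : EvenSum G) (hH : EvenSum H) : EvenSum fun x => G x + H x

theorem contDiffAt_rho {m : WithTop ℕ∞} {x : Amb n} (hx : x ≠ 0) : ContDiffAt ℝ m rho x := by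
  have h := contDiffAt_norm ℝ (n := m) hx
  have h0 : 1 + ‖x‖ ≠ 0 := by positivity
  exact (contDiffAt_const.mul (contDiffAt_const.sub h)).div (contDiffAt_const.add h) h0

/-- The boundary value `0` of `ρ²/4` is interior to the interval, so the coefficients `c` are smooth
across `ρ = 0` and even sums have values on the sphere itself. -/
theorem rho_sq_div_four_mem {x : Amb n} (hx : x ≠ 0) : rho x ^ 2 / 4 ∈ Ioo (-1 : ℝ) 1 := by
  have h0 := norm_pos_iff.2 hx
  have e : rho x ^ 2 / 4 = (1 - ‖x‖) ^ 2 / (1 + ‖x‖) ^ 2 := by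
    unfold rho; field_simp; ring
  rw [e]
  refine ⟨lt_of_lt_of_le (by norm_num) (by positivity : (0 : ℝ) ≤ _), ?_⟩
  rw [div_lt_one (by positivity)]
  nlinarith

theorem EvenSum.contDiffAt {G : Amb n → ℝ} (hG : EvenSum G) {m : ℕ∞} {x : Amb n} (hx : x ≠ 0) :
    ContDiffAt ℝ m G x := by
  induction hG with
  | term c h hc hh =>
    have h1 : ContDiffAt ℝ m c (rho x ^ 2 / 4) :=
      (hc.contDiffAt (Ioo_mem_nhds (rho_sq_div_four_mem hx).1 (rho_sq_div_four_mem hx).2)).of_le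
        (by exact_mod_cast le_top)
    exact (h1.comp x (((contDiffAt_rho hx).pow 2).div_const 4)).mul (hh.contDiffAt hx)
  | add G H _ _ ihG ihH => exact ihG.add ihH

theorem hasDerivAt_comp_rho_sq {c : ℝ → ℝ} {c' s : ℝ} (hs : 0 < s)
    (hc : HasDerivAt c c' ((2 * (1 - √s) / (1 + √s)) ^ 2 / 4)) :
    HasDerivAt (fun s => c ((2 * (1 - √s) / (1 + √s)) ^ 2 / 4))
      (c' * (-(2 * (1 - √s) / (1 + √s)) / (√s * (1 + √s) ^ 2))) s := by
  refine (hc.comp s (((hasDerivAt_rho_sq hs).pow 2).div_const 4)).congr_deriv ?_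
  have hr := Real.sqrt_pos.2 hs
  norm_num
  field_simp
  norm_num
  left; ring

/-- With `u = ρ²/4` one has `(1+‖x‖²)/(2‖x‖) = (1+u)/(1-u)` and `(1-‖x‖²)²/(4‖x‖²) = 4u/(1-u)²`, so
in polar coordinates all coefficients are smooth functions of `u`. At `u = 0` only the indicial
polynomial survives. -/
theorem EvenSum.conjD_eq {G : Amb n → ℝ} (hG : EvenSum G) (a τ : ℝ) :
    ∃ H, EvenSum H ∧ ∀ x ∈ punctured n,
      conjD n a τ G x = (τ ^ 2 - (a - n / 2) ^ 2) * G x + rho x ^ 2 * H x := by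
  induction hG with
  | term c h hc hh =>
    have hc1 : ContDiffOn ℝ ∞ (deriv c) (Ioo (-1) 1) := hc.deriv_of_isOpen isOpen_Ioo (by rfl)
    have hc2 : ContDiffOn ℝ ∞ (deriv (deriv c)) (Ioo (-1) 1) :=
      hc1.deriv_of_isOpen isOpen_Ioo (by rfl)
    have hu : ContDiffOn ℝ ∞ (fun u : ℝ => u) (Ioo (-1) 1) := contDiffOn_id
    have hu1 : ∀ u ∈ Ioo (-1 : ℝ) 1, 1 - u ≠ 0 := fun u hu => by linarith [hu.2]
    -- `e` collects the radial corrections, all divisible by `u`, after division by `ρ² = 4u`; `f`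
    -- is the coefficient of the spherical Laplacian of `h`, likewise divided.
    let e : ℝ → ℝ := fun u => (-4 * u * deriv (deriv c) u - 4 * deriv c u +
      2 * n * (1 + u) / (1 - u) * deriv c u - 4 * a * deriv c u + 2 * n * a / (1 - u) * c u) / 4
    let f : ℝ → ℝ := fun u => -c u / (1 - u) ^ 2
    have he : ContDiffOn ℝ ∞ e (Ioo (-1) 1) := by
      have h1 := contDiffOn_const (c := (1 : ℝ)) |>.sub hu
      exact ((((((contDiffOn_const.mul hu).mul hc2).sub (contDiffOn_const.mul hc1)).add
        (((contDiffOn_const.mul (contDiffOn_const.add hu)).div h1 hu1).mul hc1)).sub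
        (contDiffOn_const.mul hc1)).add ((contDiffOn_const.div h1 hu1).mul hc)).div_const 4
    have hf : ContDiffOn ℝ ∞ f (Ioo (-1) 1) :=
      hc.neg.div ((contDiffOn_const.sub hu).pow 2) fun u h => pow_ne_zero 2 (hu1 u h)
    refine ⟨_, .add _ _ (.term e h he hh) (.term f _ hf hh.laplacian), fun x hx => ?_⟩
    obtain ⟨hr0, hr1⟩ := norm_mem_Ioo hx
    have hx0 : x ≠ 0 := hx.2
    have hs0 : 0 < ‖x‖ ^ 2 := by positivity
    have hsq : √(‖x‖ ^ 2) = ‖x‖ := Real.sqrt_sq hr0.le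
    have hmem : ∀ s : ℝ, 0 < s → (2 * (1 - √s) / (1 + √s)) ^ 2 / 4 ∈ Ioo (-1 : ℝ) 1 := by
      intro s hs
      have h0 := Real.sqrt_pos.2 hs
      have e : (2 * (1 - √s) / (1 + √s)) ^ 2 / 4 = (1 - √s) ^ 2 / (1 + √s) ^ 2 := by
        field_simp; ring
      rw [e]
      refine ⟨lt_of_lt_of_le (by norm_num) (by positivity : (0 : ℝ) ≤ _), ?_⟩
      rw [div_lt_one (by positivity)]
      nlinarith
    have hd : ∀ {c : ℝ → ℝ}, ContDiffOn ℝ ∞ c (Ioo (-1) 1) → ∀ s : ℝ, 0 < s →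
        HasDerivAt c (deriv c ((2 * (1 - √s) / (1 + √s)) ^ 2 / 4))
          ((2 * (1 - √s) / (1 + √s)) ^ 2 / 4) := fun hc s hs =>
      ((hc.contDiffAt (Ioo_mem_nhds (hmem s hs).1 (hmem s hs).2)).differentiableAt
        (by simp)).hasDerivAt
    have h1 : ∀ᶠ s in 𝓝 (‖x‖ ^ 2), HasDerivAt (fun s => c ((2 * (1 - √s) / (1 + √s)) ^ 2 / 4))
        (deriv c ((2 * (1 - √s) / (1 + √s)) ^ 2 / 4) *
          (-(2 * (1 - √s) / (1 + √s)) / (√s * (1 + √s) ^ 2))) s := by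
      filter_upwards [Ioi_mem_nhds hs0] with s hs
      exact hasDerivAt_comp_rho_sq hs (hd hc s hs)
    have hm : HasDerivAt (fun s => -(2 * (1 - √s) / (1 + √s)) / (√s * (1 + √s) ^ 2)) _ (‖x‖ ^ 2) :=
      (((hasDerivAt_rho_sq hs0).mul (hasDerivAt_deriv_rho_sq hs0)).div_const 2).congr_of_eventuallyEq
        (Eventually.of_forall fun s => by simp only [Pi.mul_apply]; ring)
    have h2 := (hasDerivAt_comp_rho_sq hs0 (hd hc1 _ hs0)).mul hm
    have hF : ContDiffAt ℝ 2 (fun s => c ((2 * (1 - √s) / (1 + √s)) ^ 2 / 4)) (‖x‖ ^ 2) := by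
      have hsC : ContDiffAt ℝ 2 (fun s => √s) (‖x‖ ^ 2) := Real.contDiffAt_sqrt hs0.ne'
      have h0 : 1 + √(‖x‖ ^ 2) ≠ 0 := by positivity
      have hcC : ContDiffAt ℝ 2 c ((2 * (1 - √(‖x‖ ^ 2)) / (1 + √(‖x‖ ^ 2))) ^ 2 / 4) :=
        (hc.contDiffAt (Ioo_mem_nhds (hmem _ hs0).1 (hmem _ hs0).2)).of_le
          (WithTop.coe_le_coe.2 le_top)
      exact hcC.comp (‖x‖ ^ 2) ((((contDiffAt_const.mul (contDiffAt_const.sub hsC)).div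
        (contDiffAt_const.add hsC) h0).pow 2).div_const 4)
    have hG : (fun y : Amb n => c (rho y ^ 2 / 4) * h y) =
        fun y => c ((2 * (1 - √(‖y‖ ^ 2)) / (1 + √(‖y‖ ^ 2))) ^ 2 / 4) * h y := by
      ext y
      rw [Real.sqrt_sq (norm_nonneg y)]
      rfl
    have hh2 : ContDiffAt ℝ 2 h x := hh.contDiffAt (m := 2) hx0
    have key := hypLaplacian_radial_mul hF h1 h2 hh2
    have hfd : fderiv ℝ (fun y : Amb n => c ((2 * (1 - √(‖y‖ ^ 2)) / (1 + √(‖y‖ ^ 2))) ^ 2 / 4) *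
        h y) x x = 2 * (deriv c ((2 * (1 - √(‖x‖ ^ 2)) / (1 + √(‖x‖ ^ 2))) ^ 2 / 4) *
          (-(2 * (1 - √(‖x‖ ^ 2)) / (1 + √(‖x‖ ^ 2))) / (√(‖x‖ ^ 2) * (1 + √(‖x‖ ^ 2)) ^ 2))) *
          ‖x‖ ^ 2 * h x := by
      rw [fderiv_fun_mul ((contDiffAt_radial hF).differentiableAt (by norm_num))
        (hh2.differentiableAt (by norm_num))]
      simp only [add_apply, smul_apply, smul_eq_mul,
        fderiv_radial_apply h1.self_of_nhds, hh.fderiv_self hx0, real_inner_self_eq_norm_sq]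
      ring
    rw [hh.hypLaplacian_eq hx0, hh.fderiv_self hx0] at key
    unfold conjD
    rw [hG, hfd, key]
    simp only [hsq, e, f]
    have hρ : 2 * (1 - ‖x‖) / (1 + ‖x‖) = rho x := rfl
    have hσ : 1 - rho x ^ 2 / 4 = 4 * ‖x‖ / (1 + ‖x‖) ^ 2 := by
      unfold rho; field_simp; ring
    simp only [hρ, hσ]
    generalize c (rho x ^ 2 / 4) = c0
    generalize deriv c (rho x ^ 2 / 4) = c1
    generalize deriv (deriv c) (rho x ^ 2 / 4) = c2
    generalize Laplacian.laplacian h x = k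
    unfold rho
    have h3 : 1 - ‖x‖ ≠ 0 := by linarith
    field_simp
    ring
  | add G H hG hH ihG ihH =>
    obtain ⟨G', hG', eG⟩ := ihG
    obtain ⟨H', hH', eH⟩ := ihH
    refine ⟨_, .add G' H' hG' hH', fun x hx => ?_⟩
    have hx0 : x ≠ 0 := hx.2
    have h1 := hG.contDiffAt (m := 2) hx0
    have h2 := hH.contDiffAt (m := 2) hx0
    have e1 := hypLaplacian_add h1 h2
    have e2 : fderiv ℝ (fun x => G x + H x) x = _ := fderiv_add (h1.differentiableAt (by norm_num))
      (h2.differentiableAt (by norm_num))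
    have h3 := eG x hx
    have h4 := eH x hx
    have e3 : hypLaplacian n (fun x => G x + H x) x = _ := e1
    unfold conjD at h3 h4 ⊢
    rw [e3, e2, add_apply]
    linear_combination h3 + h4

/-! ### Functions vanishing to finite order at the boundary -/

/-- The filter of approach to the unit sphere from inside. -/
def bdryFilter (n : ℕ) : Filter (Amb n) := comap norm (𝓝[<] 1)

theorem eventually_bdryFilter {p : Amb n → Prop} :
    (∀ᶠ x in bdryFilter n, p x) ↔ ∃ r < 1, ∀ x, r < ‖x‖ → ‖x‖ < 1 → p x := by
  rw [bdryFilter, ((nhdsLT_basis (1 : ℝ)).comap norm).eventually_iff]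
  simp only [mem_preimage, mem_Ioo, and_imp]

theorem eventually_bdryFilter_gt {r : ℝ} (hr : r < 1) :
    ∀ᶠ x in bdryFilter n, r < ‖x‖ ∧ ‖x‖ < 1 :=
  eventually_bdryFilter.2 ⟨r, hr, fun _ h1 h2 => ⟨h1, h2⟩⟩

theorem nhdsWithin_le_bdryFilter (ξ : Sph n) : 𝓝[openBall n] (ξ : Amb n) ≤ bdryFilter n := by
  rw [bdryFilter, ← tendsto_iff_comap, tendsto_nhdsWithin_iff]
  constructor
  · have := (continuous_norm.tendsto (ξ : Amb n)).mono_left (nhdsWithin_le_nhds (s := openBall n))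
    rwa [norm_sphere] at this
  · filter_upwards [self_mem_nhdsWithin] with x hx using mem_ball_zero_iff.1 hx

theorem isBigO_one_of_continuousAt {κ : ℝ → ℝ} (hκ : ContinuousAt κ 1) :
    (fun x : Amb n => κ ‖x‖) =O[bdryFilter n] fun _ => (1 : ℝ) := by
  have h : Tendsto (fun x : Amb n => ‖x‖) (bdryFilter n) (𝓝 1) :=
    tendsto_comap.mono_right nhdsWithin_le_nhds
  exact (hκ.tendsto.comp h).isBigO_one ℝ

theorem isBigO_pow_of_le {M N : ℕ} (h : M ≤ N) :
    (fun x : Amb n => (1 - ‖x‖) ^ N) =O[bdryFilter n] fun x => (1 - ‖x‖) ^ M := by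
  refine Asymptotics.IsBigO.of_bound 1 ?_
  filter_upwards [eventually_bdryFilter_gt (zero_lt_one' ℝ)] with x hx
  have h1 : 0 ≤ 1 - ‖x‖ := by linarith [hx.2]
  rw [norm_pow, norm_pow, Real.norm_of_nonneg h1, one_mul]
  exact pow_le_pow_of_le_one h1 (by linarith [hx.1]) h

/-- The punctured closed ball. -/
abbrev puncturedClosed (n : ℕ) : Set (Amb n) := closedBall 0 1 \ {0}

theorem uniqueDiffOn_puncturedClosed : UniqueDiffOn ℝ (puncturedClosed n) := by
  have h : UniqueDiffOn ℝ (closedBall (0 : Amb n) 1) :=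
    uniqueDiffOn_convex (convex_closedBall _ _) ⟨0, ball_subset_interior_closedBall (by simp)⟩
  exact h.inter isOpen_compl_singleton

theorem puncturedClosed_mem_nhds {x : Amb n} (hx : x ∈ punctured n) :
    puncturedClosed n ∈ 𝓝 x :=
  mem_of_superset (isOpen_punctured.mem_nhds hx) (sdiff_subset_sdiff_left ball_subset_closedBall)

theorem mem_punctured {x : Amb n} (h0 : 0 < ‖x‖) (h1 : ‖x‖ < 1) : x ∈ punctured n :=
  ⟨mem_ball_zero_iff.2 h1, norm_pos_iff.1 h0⟩

/-- Interpolation: a function of class `C²` up to the boundary which is `O((1 - |x|)^{2M})`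
has derivative `O((1 - |x|)^M)`. -/
theorem isBigO_fderivWithin {F : Type*} [NormedAddCommGroup F] [NormedSpace ℝ F] {g : Amb n → F}
    {M : ℕ} (hM : 1 ≤ M) (hg : ContDiffOn ℝ 2 g (puncturedClosed n))
    (h : g =O[bdryFilter n] fun x => (1 - ‖x‖) ^ (2 * M)) :
    fderivWithin ℝ g (puncturedClosed n) =O[bdryFilter n] fun x => (1 - ‖x‖) ^ M := by
  have hX := uniqueDiffOn_puncturedClosed (n := n)
  have hg1 : ContDiffOn ℝ 1 (fderivWithin ℝ g (puncturedClosed n)) (puncturedClosed n) :=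
    hg.fderivWithin hX (by norm_num)
  have hg2 : ContinuousOn (fderivWithin ℝ (fderivWithin ℝ g (puncturedClosed n))
      (puncturedClosed n)) (puncturedClosed n) :=
    hg1.continuousOn_fderivWithin hX le_rfl
  have hK : IsCompact (closedBall (0 : Amb n) 1 ∩ {x | 1 / 2 ≤ ‖x‖}) :=
    (isCompact_closedBall _ _).inter_right (isClosed_le continuous_const continuous_norm)
  have hKX : closedBall (0 : Amb n) 1 ∩ {x | 1 / 2 ≤ ‖x‖} ⊆ puncturedClosed n := by
    rintro x ⟨h1, h2⟩
    refine ⟨h1, fun h0 => ?_⟩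
    change 1 / 2 ≤ ‖x‖ at h2
    rw [mem_singleton_iff.1 h0] at h2
    norm_num at h2
  obtain ⟨K, hKb⟩ := hK.exists_bound_of_continuousOn
    (f := fderivWithin ℝ (fderivWithin ℝ g (puncturedClosed n)) (puncturedClosed n))
    (hg2.mono hKX)
  have hfd : ∀ x ∈ punctured n, fderivWithin ℝ g (puncturedClosed n) x = fderiv ℝ g x :=
    fun x hx => fderivWithin_of_mem_nhds (puncturedClosed_mem_nhds hx)
  have hfdd : ∀ x ∈ punctured n, fderivWithin ℝ (fderivWithin ℝ g (puncturedClosed n))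
      (puncturedClosed n) x = fderiv ℝ (fderiv ℝ g) x := fun x hx => by
    rw [fderivWithin_of_mem_nhds (puncturedClosed_mem_nhds hx)]
    refine Filter.EventuallyEq.fderiv_eq ?_
    filter_upwards [isOpen_punctured.mem_nhds hx] with y hy using hfd y hy
  have hC2 : ∀ x ∈ punctured n, ContDiffAt ℝ 2 g x := fun x hx =>
    hg.contDiffAt (puncturedClosed_mem_nhds hx)
  obtain ⟨C, hC0, hC⟩ := h.exists_pos
  obtain ⟨r, hr1, hr⟩ := eventually_bdryFilter.1 hC.bound
  set K' := max K 0
  refine Asymptotics.IsBigO.of_bound (K' / 2 + 2 * C * (4 ^ M + 1)) ?_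
  -- Both bounds leave room for the ball of radius `(1 - ‖x‖)/2` about `x`: it stays in the shell
  -- where the second derivative is bounded and in the region where the estimate for `g` holds.
  filter_upwards [eventually_bdryFilter_gt (show max (3 / 4) ((1 + r) / 2) < 1 from
    max_lt (by norm_num) (by linarith))] with x ⟨hx0, hx1⟩
  have hx34 : 3 / 4 < ‖x‖ := (le_max_left _ _).trans_lt hx0
  have hxr : (1 + r) / 2 < ‖x‖ := (le_max_right _ _).trans_lt hx0
  set y := 1 - ‖x‖ with hy
  have hy0 : 0 < y := by linarith
  have hy1 : y ≤ 1 := by linarith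
  -- A difference quotient of step `s` bounds the derivative by about `K s + sup ‖g‖ / s`. As `g =
  -- O(y^{2M})`, the balance is at `s ~ y^M`; with `M ≥ 1` the ball of radius `s` stays within
  -- distance `y/2`, hence inside the unit ball.
  set s := y ^ M / 2 with hs
  have hyM : 0 < y ^ M := pow_pos hy0 M
  have hs0 : 0 < s := by positivity
  have hsy : s ≤ y / 2 := by
    have : y ^ M ≤ y ^ 1 := pow_le_pow_of_le_one hy0.le hy1 hM
    rw [pow_one] at this
    linarith
  have hnear : ∀ z ∈ closedBall x s, 1 / 2 < ‖z‖ ∧ r < ‖z‖ ∧ ‖z‖ < 1 ∧ 1 - ‖z‖ ≤ 2 * y := by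
    intro z hz
    rw [mem_closedBall, dist_eq_norm] at hz
    have h1 := norm_sub_norm_le x z
    have h2 := norm_sub_norm_le z x
    rw [norm_sub_rev] at h1
    refine ⟨?_, ?_, ?_, ?_⟩ <;> linarith
  have hballΩ : ∀ z ∈ closedBall x s, z ∈ punctured n := fun z hz => by
    obtain ⟨h1, _, h3, _⟩ := hnear z hz
    exact mem_punctured (by linarith) h3
  have hxm : x ∈ closedBall x s := mem_closedBall_self hs0.le
  have hD : ∀ z ∈ closedBall x s, ‖fderiv ℝ g z - fderiv ℝ g x‖ ≤ K' * s := by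
    intro z hz
    have h1 := (convex_closedBall x s).norm_image_sub_le_of_norm_fderiv_le (f := fderiv ℝ g)
      (𝕜 := ℝ) (C := K') (fun w hw => contDiffAt_two_fderiv (hC2 w (hballΩ w hw)))
      (fun w hw => by
        rw [← hfdd w (hballΩ w hw)]
        obtain ⟨h1, _, h3, _⟩ := hnear w hw
        exact (hKb w ⟨mem_closedBall_zero_iff.2 h3.le, h1.le⟩).trans (le_max_left _ _)) hxm hz
    refine h1.trans ?_
    rw [mem_closedBall, dist_eq_norm] at hz
    exact mul_le_mul_of_nonneg_left hz (le_max_right _ _)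
  have hbound : ∀ z ∈ closedBall x s, ‖g z‖ ≤ C * (2 * y) ^ (2 * M) := by
    intro z hz
    obtain ⟨_, h2, h3, h4⟩ := hnear z hz
    have h5 := hr z h2 h3
    rw [norm_pow, Real.norm_of_nonneg (by linarith)] at h5
    exact h5.trans (mul_le_mul_of_nonneg_left (pow_le_pow_left₀ (by linarith) h4 _) hC0.le)
  have hboundx : ‖g x‖ ≤ C * y ^ (2 * M) := by
    have h5 := hr x (by linarith) hx1
    rwa [norm_pow, Real.norm_of_nonneg hy0.le] at h5
  rw [hfd x (hballΩ x hxm), norm_pow, Real.norm_of_nonneg hy0.le]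
  refine ContinuousLinearMap.opNorm_le_of_unit_norm (by positivity) fun v hv => ?_
  have hz : x + s • v ∈ closedBall x s := by
    rw [mem_closedBall, dist_eq_norm, add_sub_cancel_left, norm_smul, hv, mul_one,
      Real.norm_of_nonneg hs0.le]
  have hmv := (convex_closedBall x s).norm_image_sub_le_of_norm_fderiv_le' (𝕜 := ℝ) (f := g)
    (fun w hw => (hC2 w (hballΩ w hw)).differentiableAt (by norm_num)) hD hxm hz
  rw [add_sub_cancel_left, map_smul, norm_smul, hv, mul_one, Real.norm_of_nonneg hs0.le] at hmv
  have h1 : s * ‖fderiv ℝ g x v‖ ≤ K' * s * s + C * (2 * y) ^ (2 * M) + C * y ^ (2 * M) := by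
    have h2 : s * ‖fderiv ℝ g x v‖ = ‖s • fderiv ℝ g x v‖ := by
      rw [norm_smul, Real.norm_of_nonneg hs0.le]
    have h3 : s • fderiv ℝ g x v =
        g (x + s • v) - g x - (g (x + s • v) - g x - s • fderiv ℝ g x v) := by abel
    rw [h2, h3]
    refine (norm_sub_le _ _).trans ?_
    have h4 := norm_sub_le (g (x + s • v)) (g x)
    linarith [hbound _ hz]
  have h2 : (2 * y) ^ (2 * M) = 4 ^ M * (y ^ M * y ^ M) := by
    rw [mul_pow, pow_mul 2, ← pow_add, ← two_mul]; norm_num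
  have h3 : y ^ (2 * M) = y ^ M * y ^ M := by rw [two_mul, pow_add]
  rw [h2, h3, hs] at h1
  have h4 : y ^ M / 2 * ‖fderiv ℝ g x v‖ ≤
      y ^ M / 2 * ((K' / 2 + 2 * C * (4 ^ M + 1)) * y ^ M) := by
    refine h1.trans (le_of_eq ?_)
    ring
  exact le_of_mul_le_mul_left h4 (by positivity)

/-- `R` is smooth on the punctured closed ball and vanishes to order `M` at the boundary. -/
def Flat (M : ℕ) (R : Amb n → ℝ) : Prop :=
  ContDiffOn ℝ ∞ R (puncturedClosed n) ∧ R =O[bdryFilter n] fun x => (1 - ‖x‖) ^ M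

/-- Each of two derivatives halves the order of vanishing. Derivatives within the closed punctured
ball keep the result smooth up to the sphere, so that the lemma can be iterated. -/
theorem Flat.conjD_eq {M : ℕ} (hM : 1 ≤ M) {R : Amb n → ℝ} (hR : Flat (4 * M) R) (a τ : ℝ) :
    ∃ R', Flat M R' ∧ ∀ x ∈ punctured n, conjD n a τ R x = R' x := by
  obtain ⟨hRs, hRO⟩ := hR
  have hX := uniqueDiffOn_puncturedClosed (n := n)
  set D1 := fderivWithin ℝ R (puncturedClosed n) with hD1
  set D2 := fderivWithin ℝ D1 (puncturedClosed n) with hD2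
  have hD1s : ContDiffOn ℝ ∞ D1 (puncturedClosed n) := hRs.fderivWithin hX (by rfl)
  have hD2s : ContDiffOn ℝ ∞ D2 (puncturedClosed n) := hD1s.fderivWithin hX (by rfl)
  have hD1O : D1 =O[bdryFilter n] fun x => (1 - ‖x‖) ^ (2 * M) :=
    isBigO_fderivWithin (by omega) (hRs.of_le (WithTop.coe_le_coe.2 le_top))
      (by rwa [← mul_assoc])
  have hD2O : D2 =O[bdryFilter n] fun x => (1 - ‖x‖) ^ M :=
    isBigO_fderivWithin hM (hD1s.of_le (WithTop.coe_le_coe.2 le_top)) hD1O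
  have hns : ContDiffOn ℝ ∞ (fun x : Amb n => ‖x‖) (puncturedClosed n) := fun x hx =>
    (contDiffAt_norm ℝ hx.2).contDiffWithinAt
  have hn0 : ∀ x ∈ puncturedClosed n, ‖x‖ ≠ 0 := fun x hx => norm_ne_zero_iff.2 hx.2
  have hys : ContDiffOn ℝ ∞ (fun x : Amb n => 1 - ‖x‖ ^ 2) (puncturedClosed n) :=
    contDiffOn_const.sub (hns.pow 2)
  have hD1x : ContDiffOn ℝ ∞ (fun x => D1 x x) (puncturedClosed n) := hD1s.clm_apply contDiffOn_id
  have hD2x : ContDiffOn ℝ ∞ (fun x => ∑ i, D2 x (stdBasis n i) (stdBasis n i))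
      (puncturedClosed n) :=
    ContDiffOn.sum fun i _ => (hD2s.clm_apply contDiffOn_const).clm_apply contDiffOn_const
  have hD1xO : (fun x => D1 x x) =O[bdryFilter n] fun x => (1 - ‖x‖) ^ M := by
    refine Asymptotics.IsBigO.trans (Asymptotics.IsBigO.of_bound 1 ?_)
      (hD1O.trans (isBigO_pow_of_le (by omega)))
    filter_upwards [eventually_bdryFilter_gt (zero_lt_one' ℝ)] with x hx
    rw [one_mul]
    refine ((D1 x).le_opNorm x).trans ?_
    exact mul_le_of_le_one_right (norm_nonneg _) hx.2.le
  have hD2xO : (fun x => ∑ i, D2 x (stdBasis n i) (stdBasis n i)) =O[bdryFilter n]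
      fun x => (1 - ‖x‖) ^ M := by
    refine Asymptotics.IsBigO.fun_sum fun i _ =>
      Asymptotics.IsBigO.trans (g := D2) (Asymptotics.IsBigO.of_bound 1 ?_) hD2O
    filter_upwards with x
    have h1 := ((D2 x) (stdBasis n i)).le_opNorm (stdBasis n i)
    have h2 := (D2 x).le_opNorm (stdBasis n i)
    rw [OrthonormalBasis.norm_eq_one, mul_one] at h1 h2
    rw [one_mul]
    exact h1.trans h2
  have hcoef : ∀ {κ : ℝ → ℝ} {f : Amb n → ℝ}, ContinuousAt κ 1 →
      (f =O[bdryFilter n] fun x => (1 - ‖x‖) ^ M) →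
      (fun x => κ ‖x‖ * f x) =O[bdryFilter n] fun x => (1 - ‖x‖) ^ M := fun hκ hf => by
    simpa using (isBigO_one_of_continuousAt hκ).mul hf
  refine ⟨fun x => -((1 - ‖x‖ ^ 2) / 4 * ((1 - ‖x‖ ^ 2) *
    (∑ i, D2 x (stdBasis n i) (stdBasis n i)) + 2 * ((n : ℝ) - 1) * D1 x x)) +
    a * (1 - ‖x‖ ^ 2) / ‖x‖ * D1 x x + (-a ^ 2 + n * a * (1 + ‖x‖ ^ 2) / (2 * ‖x‖) -
    ((n : ℝ) / 2 + τ) * (n / 2 - τ)) * R x, ⟨?_, ?_⟩, fun x hx => ?_⟩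
  · refine ((((hys.div_const 4).mul ((hys.mul hD2x).add (contDiffOn_const.mul hD1x))).neg).add
      (((contDiffOn_const.mul hys).div hns hn0).mul hD1x)).add (ContDiffOn.mul ?_ hRs)
    exact (contDiffOn_const.add ((contDiffOn_const.mul (contDiffOn_const.add (hns.pow 2))).div
      (contDiffOn_const.mul hns) fun x hx => mul_ne_zero two_ne_zero (hn0 x hx))).sub
      contDiffOn_const
  · refine (((hcoef (κ := fun r => (1 - r ^ 2) / 4) (by fun_prop) ((hcoef
      (κ := fun r => 1 - r ^ 2) (by fun_prop) hD2xO).add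
      (hD1xO.const_mul_left _))).neg_left).add (hcoef (κ := fun r => a * (1 - r ^ 2) / r) ?_
      hD1xO)).add (hcoef (κ := fun r => -a ^ 2 + n * a * (1 + r ^ 2) / (2 * r) -
      ((n : ℝ) / 2 + τ) * (n / 2 - τ)) ?_ (hRO.trans (isBigO_pow_of_le (by omega))))
    · exact ContinuousAt.div (by fun_prop) (by fun_prop) (by norm_num)
    · exact (continuousAt_const.add (ContinuousAt.div (by fun_prop) (by fun_prop)
        (by norm_num))).sub continuousAt_const
  · have hfd : ∀ x ∈ punctured n, D1 x = fderiv ℝ R x :=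
      fun x hx => fderivWithin_of_mem_nhds (puncturedClosed_mem_nhds hx)
    have hfdd : D2 x = fderiv ℝ (fderiv ℝ R) x := by
      rw [hD2, fderivWithin_of_mem_nhds (puncturedClosed_mem_nhds hx)]
      refine Filter.EventuallyEq.fderiv_eq ?_
      filter_upwards [isOpen_punctured.mem_nhds hx] with y hy using hfd y hy
    simp only [conjD, hypLaplacian, laplacian_apply, hfd x hx, hfdd]

/-! ### Boundary expansions -/

theorem EvenSum.const_mul {G : Amb n → ℝ} (hG : EvenSum G) (k : ℝ) :
    EvenSum fun x => k * G x := by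
  induction hG with
  | term c h hc hh =>
    simpa only [mul_assoc] using EvenSum.term (fun u => k * c u) h (contDiffOn_const.mul hc) hh
  | add G H _ _ ihG ihH => simpa only [mul_add] using EvenSum.add _ _ ihG ihH

theorem EvenSum.rho_sq_mul {G : Amb n → ℝ} (hG : EvenSum G) :
    EvenSum fun x => rho x ^ 2 * G x := by
  induction hG with
  | term c h hc hh =>
    have h1 := EvenSum.term (fun u => 4 * u * c u) h
      ((contDiffOn_const.mul contDiffOn_id).mul hc) hh
    convert h1 using 2
    ring
  | add G H _ _ ihG ihH => simpa only [mul_add] using EvenSum.add _ _ ihG ihH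

theorem evenSum_zero : EvenSum fun _ : Amb n => (0 : ℝ) := by
  simpa using EvenSum.term (n := n) (fun _ => 0) (fun _ => 0) contDiffOn_const
    ⟨contDiffOn_const, fun _ _ _ => rfl⟩

theorem evenSum_sum {a : ℕ → Sph n → ℝ} (ha : ∀ i, ContMDiff (𝓡 n) 𝓘(ℝ, ℝ) ∞ (a i)) (N : ℕ) :
    EvenSum fun x => ∑ i ∈ Finset.range N, rho x ^ (2 * i) * angularExt (a i) x := by
  induction N with
  | zero => simpa using evenSum_zero
  | succ N ih =>
    simp only [Finset.sum_range_succ]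
    refine EvenSum.add _ _ ih ?_
    have h1 := EvenSum.term (fun u => (4 * u) ^ N) _
      ((contDiffOn_const.mul contDiffOn_id).pow N) (isAngular_angularExt (ha N))
    convert h1 using 2
    rw [pow_mul]
    congr 1
    ring

/-- On the punctured ball `u = ρ^b G + ρ^a R` with `G` even in `ρ` and `R` vanishing to order `M`
at the boundary. -/
def HasExpansion (b a : ℝ) (M : ℕ) (u : Amb n → ℝ) : Prop :=
  ∃ G R, EvenSum G ∧ Flat M R ∧
    EqOn u (fun x => rho x ^ b * G x + 1 * (rho x ^ a * R x)) (punctured n)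

theorem HasExpansion.congr {b a : ℝ} {M : ℕ} {u v : Amb n → ℝ} (h : HasExpansion b a M u)
    (huv : EqOn u v (punctured n)) : HasExpansion b a M v := by
  obtain ⟨G, R, hG, hR, e⟩ := h
  exact ⟨G, R, hG, hR, huv.symm.trans e⟩

theorem contDiffAt_rho_rpow {m : WithTop ℕ∞} (b : ℝ) {x : Amb n} (hx : x ∈ punctured n) :
    ContDiffAt ℝ m (fun y => rho y ^ b) x :=
  (contDiffAt_rho hx.2).rpow_const_of_ne (rho_pos hx.1).ne'

theorem Flat.contDiffAt {M : ℕ} {R : Amb n → ℝ} (hR : Flat M R) {x : Amb n}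
    (hx : x ∈ punctured n) : ContDiffAt ℝ ∞ R x :=
  hR.1.contDiffAt (puncturedClosed_mem_nhds hx)

theorem HasExpansion.contDiffOn {b a : ℝ} {M : ℕ} {u : Amb n → ℝ} (h : HasExpansion b a M u) :
    ContDiffOn ℝ ∞ u (punctured n) := by
  obtain ⟨G, R, hG, hR, e⟩ := h
  refine ContDiffOn.congr (fun x hx => ContDiffAt.contDiffWithinAt ?_) e
  exact ((contDiffAt_rho_rpow b hx).mul (hG.contDiffAt hx.2)).add
    (contDiffAt_const.mul ((contDiffAt_rho_rpow a hx).mul (hR.contDiffAt hx)))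

/-- The indicial coefficient is left visible so that both cases can be read off: in general `b` is
kept, and at an indicial root it rises by two. The exponent `a` of the remainder never moves; only
its order drops. -/
theorem opD_expansion {b a : ℝ} {M : ℕ} (hM : 1 ≤ M) {u : Amb n → ℝ}
    (h : HasExpansion b a (4 * M) u) (τ : ℝ) :
    ∃ G H R, EvenSum G ∧ EvenSum H ∧ Flat M R ∧ ∀ x ∈ punctured n,
      opD n ((n : ℝ) / 2 + τ) u x =
        rho x ^ b * ((τ ^ 2 - (b - n / 2) ^ 2) * G x + rho x ^ 2 * H x) + rho x ^ a * R x := by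
  obtain ⟨G, R, hG, hR, e⟩ := h
  obtain ⟨H, hH, eH⟩ := hG.conjD_eq b τ
  obtain ⟨R', hR', eR⟩ := hR.conjD_eq hM a τ
  refine ⟨G, H, R', hG, hH, hR', fun x hx => ?_⟩
  have hG2 : ContDiffAt ℝ 2 G x := hG.contDiffAt (m := 2) hx.2
  have hR2 : ContDiffAt ℝ 2 R x := (hR.contDiffAt hx).of_le (WithTop.coe_le_coe.2 le_top)
  rw [opD_congr _ (e.eventuallyEq_of_mem (isOpen_punctured.mem_nhds hx)),
    opD_add_const_mul _ _ ((contDiffAt_rho_rpow b hx).mul hG2)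
      ((contDiffAt_rho_rpow a hx).mul hR2), opD_rho_rpow_mul b τ hx hG2,
    opD_rho_rpow_mul a τ hx hR2, one_mul, ← eH x hx, ← eR x hx]
  rfl

theorem HasExpansion.opD {b a : ℝ} {M : ℕ} (hM : 1 ≤ M) {u : Amb n → ℝ}
    (h : HasExpansion b a (4 * M) u) (τ : ℝ) :
    HasExpansion b a M (opD n ((n : ℝ) / 2 + τ) u) := by
  obtain ⟨G, H, R, hG, hH, hR, e⟩ := opD_expansion hM h τ
  refine ⟨_, R, .add _ _ (hG.const_mul (τ ^ 2 - (b - n / 2) ^ 2)) hH.rho_sq_mul, hR,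
    fun x hx => ?_⟩
  simp only [e x hx, one_mul]

/-- A factor `D` whose indicial root is the leading exponent raises that exponent by two. -/
theorem HasExpansion.opD_of_indicial {b a : ℝ} {M : ℕ} (hM : 1 ≤ M) {u : Amb n → ℝ}
    (h : HasExpansion b a (4 * M) u) {τ : ℝ} (hτ : τ ^ 2 = (b - n / 2) ^ 2) :
    HasExpansion (b + 2) a M (PoincareBall.opD n ((n : ℝ) / 2 + τ) u) := by
  obtain ⟨G, H, R, hG, hH, hR, e⟩ := opD_expansion hM h τ
  refine ⟨H, R, hH, hR, fun x hx => ?_⟩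
  have h2 : rho x ^ (b + 2) = rho x ^ b * rho x ^ 2 := by
    rw [Real.rpow_add (rho_pos hx.1), Real.rpow_two]
  simp only [e x hx, h2, hτ]
  ring

theorem HasExpansion.prodD {b a γ : ℝ} {M : ℕ} (hM : 1 ≤ M) (L : List ℕ) {u : Amb n → ℝ}
    (h : HasExpansion b a (4 ^ L.length * M) u) : HasExpansion b a M (prodD n γ L u) := by
  induction L generalizing M with
  | nil => simpa [PoincareBall.prodD] using h
  | cons l L ih =>
    rw [prodD_cons, add_sub_assoc]
    refine HasExpansion.opD hM (ih (by omega) ?_) _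
    convert h using 1
    rw [List.length_cons]
    ring

theorem HasExpansion.prodD_range {a γ : ℝ} {M : ℕ} (hM : 1 ≤ M) (i : ℕ) {u : Amb n → ℝ}
    (h : HasExpansion ((n : ℝ) / 2 - γ) a (4 ^ i * M) u) :
    HasExpansion ((n : ℝ) / 2 - γ + 2 * i) a M (PoincareBall.prodD n γ (List.range i) u) := by
  -- The exponent climbs only if the factor `l = 0` acts first, then `l = 1`, and so on; `prodD`
  -- applies the last entry first, hence the reversal, undone by commutativity.
  have hrev : HasExpansion ((n : ℝ) / 2 - γ + 2 * i) a M
      (PoincareBall.prodD n γ (List.range i).reverse u) := by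
    induction i generalizing M with
    | zero => simpa [PoincareBall.prodD] using h
    | succ i ih =>
      have h1 := ih (M := 4 * M) (by omega) (by convert h using 1; ring)
      rw [List.range_succ, List.reverse_append, List.reverse_singleton, List.singleton_append,
        prodD_cons, add_sub_assoc]
      have h2 := h1.opD_of_indicial hM (τ := γ - 2 * i) (by ring)
      convert h2 using 1
      push_cast
      ring
  exact hrev.congr (prodD_perm γ (List.reverse_perm _) isOpen_punctured
    (contDiffOn_infty.1 h.contDiffOn _))

/-- The exponents `n/2 + γ - 2l` climb as `l` decreases from `⌊γ⌋₊`, which is already the order in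
which `prodD` applies these factors. -/
theorem HasExpansion.prodD_Ico {a γ : ℝ} {M : ℕ} (hM : 1 ≤ M) {j : ℕ} (hj : j ≤ ⌊γ⌋₊)
    {u : Amb n → ℝ} (h : HasExpansion ((n : ℝ) / 2 + γ - 2 * ⌊γ⌋₊) a (4 ^ j * M) u) :
    HasExpansion ((n : ℝ) / 2 + γ - 2 * ⌊γ⌋₊ + 2 * j) a M
      (PoincareBall.prodD n γ (List.Ico (⌊γ⌋₊ - j + 1) (⌊γ⌋₊ + 1)) u) := by
  induction j generalizing M with
  | zero => simpa [PoincareBall.prodD] using h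
  | succ j ih =>
    have h1 := ih (M := 4 * M) (by omega) (by omega) (by convert h using 1; ring)
    have e : ⌊γ⌋₊ - (j + 1) + 1 = ⌊γ⌋₊ - j := by omega
    rw [e, List.Ico.eq_cons (by omega : ⌊γ⌋₊ - j < ⌊γ⌋₊ + 1), prodD_cons,
      add_sub_assoc _ γ (2 * ((⌊γ⌋₊ - j : ℕ) : ℝ))]
    have h2 := h1.opD_of_indicial hM (τ := γ - 2 * ((⌊γ⌋₊ - j : ℕ) : ℝ)) (by
      rw [Nat.cast_sub (by omega)]; ring)
    convert h2 using 1
    push_cast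
    ring

theorem rho_le {x : Amb n} (hx : ‖x‖ < 1) : rho x ≤ 2 * (1 - ‖x‖) := by
  have := norm_nonneg x
  unfold rho
  rw [div_le_iff₀ (by linarith)]
  nlinarith

theorem one_sub_norm_le_rho {x : Amb n} (hx : ‖x‖ < 1) : 1 - ‖x‖ ≤ rho x := by
  have := norm_nonneg x
  unfold rho
  rw [le_div_iff₀ (by linarith)]
  nlinarith

/-- The coefficients are extended along rays and the series is truncated; the remainder is then
smooth up to the sphere, and `ρ` is comparable with `1 - ‖x‖`. -/
theorem SmoothEven.hasExpansion {f : Amb n → ℝ} (hf : SmoothEven n f) (a : ℝ) (M : ℕ) :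
    HasExpansion a a M (fun x => rho x ^ a * f x) := by
  obtain ⟨hfs, c, hc, hexp⟩ := hf
  obtain ⟨C, hC⟩ := hexp M
  have hG := evenSum_sum hc M
  refine ⟨_, fun x => f x - ∑ i ∈ Finset.range M, rho x ^ (2 * i) * angularExt (c i) x, hG,
    ⟨?_, ?_⟩, fun x _ => by ring⟩
  · exact (hfs.mono sdiff_subset).sub fun x hx =>
      (hG.contDiffAt (m := ⊤) hx.2).contDiffWithinAt
  · refine Asymptotics.IsBigO.trans ?_ (isBigO_pow_of_le (by omega : M ≤ 2 * M))
    refine Asymptotics.IsBigO.of_bound (|C| * 2 ^ (2 * M)) ?_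
    filter_upwards [eventually_bdryFilter_gt (zero_lt_one' ℝ)] with x ⟨h0, h1⟩
    have hx0 : x ≠ 0 := norm_pos_iff.1 h0
    let ξ : Sph n := ⟨‖x‖⁻¹ • x, by simp [norm_smul, hx0]⟩
    have hξ : ‖x‖ • (ξ : Amb n) = x := by
      simp only [ξ, smul_smul]
      rw [mul_inv_cancel₀ h0.ne', one_smul]
    have h2 := hC ξ ‖x‖ ⟨h0.le, h1.le⟩
    have h3 : ∀ i, c i ξ = angularExt (c i) x := fun i => by
      rw [← angularExt_smul (a := c i) h0 ξ, hξ]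
    simp only [hξ, h3] at h2
    have h4 := one_sub_norm_le_rho h1
    have h5 := rho_le h1
    have h6 : 0 ≤ 1 - ‖x‖ := by linarith
    rw [Real.norm_eq_abs, norm_pow, Real.norm_of_nonneg h6, mul_assoc, ← mul_pow]
    calc _ ≤ C * rho x ^ (2 * M) := h2
      _ ≤ |C| * rho x ^ (2 * M) :=
        mul_le_mul_of_nonneg_right (le_abs_self C) (pow_nonneg (h6.trans h4) _)
      _ ≤ |C| * (2 * (1 - ‖x‖)) ^ (2 * M) :=
        mul_le_mul_of_nonneg_left (pow_le_pow_left₀ (h6.trans h4) h5 _) (abs_nonneg C)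

theorem tendsto_rho (ξ : Sph n) : Tendsto rho (𝓝[openBall n] (ξ : Amb n)) (𝓝 0) := by
  have hξ := norm_sphere ξ
  have h0 : (ξ : Amb n) ≠ 0 := norm_ne_zero_iff.1 (by rw [hξ]; norm_num)
  have h := (contDiffAt_rho (m := 0) h0).continuousAt.tendsto.mono_left
    (nhdsWithin_le_nhds (s := openBall n))
  have e : rho (ξ : Amb n) = 0 := by simp [rho, hξ]
  rwa [e] at h

theorem eventually_mem_punctured (ξ : Sph n) :
    ∀ᶠ x in 𝓝[openBall n] (ξ : Amb n), x ∈ punctured n := by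
  filter_upwards [nhdsWithin_le_bdryFilter ξ (eventually_bdryFilter_gt (zero_lt_one' ℝ))] with x hx
  exact mem_punctured hx.1 hx.2

theorem tendsto_rho_rpow {p : ℝ} (hp : 0 < p) (ξ : Sph n) :
    Tendsto (fun x => rho x ^ p) (𝓝[openBall n] (ξ : Amb n)) (𝓝 0) := by
  have := (tendsto_rho ξ).rpow_const (p := p) (Or.inr hp.le)
  rwa [Real.zero_rpow hp.ne'] at this

/-- The even part tends to its boundary value if `b₀ = b` and to zero if `b₀ < b`; the flat part is
of size `ρ^{a + M - b₀}` and disappears. -/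
theorem HasExpansion.exists_tendsto {b a b₀ : ℝ} {M : ℕ} {u : Amb n → ℝ}
    (h : HasExpansion b a M u) (hb : b₀ ≤ b) (hM : b₀ < a + M) (ξ : Sph n) :
    ∃ y, Tendsto (fun x => rho x ^ (-b₀) * u x) (𝓝[openBall n] (ξ : Amb n)) (𝓝 y) := by
  obtain ⟨G, R, hG, hR, e⟩ := h
  have h0 : (ξ : Amb n) ≠ 0 := norm_ne_zero_iff.1 (by rw [norm_sphere ξ]; norm_num)
  have hG1 : Tendsto G (𝓝[openBall n] (ξ : Amb n)) (𝓝 (G ξ)) :=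
    (hG.contDiffAt (m := 0) h0).continuousAt.tendsto.mono_left nhdsWithin_le_nhds
  have hG2 : ∃ y, Tendsto (fun x => rho x ^ (b - b₀) * G x) (𝓝[openBall n] (ξ : Amb n)) (𝓝 y) := by
    rcases hb.eq_or_lt with rfl | hlt
    · exact ⟨G ξ, by simpa using hG1⟩
    · exact ⟨_, (tendsto_rho_rpow (sub_pos.2 hlt) ξ).mul hG1⟩
  obtain ⟨y, hy⟩ := hG2
  have hR1 : Tendsto (fun x => rho x ^ (a - b₀) * R x) (𝓝[openBall n] (ξ : Amb n)) (𝓝 0) := by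
    obtain ⟨C, hC0, hC⟩ := hR.2.exists_pos
    have h1 := (tendsto_rho_rpow (show 0 < a + M - b₀ by linarith) ξ).const_mul C
    rw [mul_zero] at h1
    refine squeeze_zero_norm' ?_ h1
    filter_upwards [nhdsWithin_le_bdryFilter ξ hC.bound, self_mem_nhdsWithin] with x h2 hx
    have hx' := mem_ball_zero_iff.1 hx
    have hρ := rho_pos hx
    have h3 : 0 ≤ 1 - ‖x‖ := by linarith
    have h4 := Real.rpow_pos_of_pos hρ (a - b₀)
    rw [norm_pow, Real.norm_of_nonneg h3] at h2
    rw [norm_mul, Real.norm_of_nonneg h4.le]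
    have h5 : rho x ^ (a + M - b₀) = rho x ^ (a - b₀) * rho x ^ M := by
      rw [← Real.rpow_natCast, ← Real.rpow_add hρ]
      congr 1
      ring
    calc _ ≤ rho x ^ (a - b₀) * (C * rho x ^ M) := by
          refine mul_le_mul_of_nonneg_left (h2.trans ?_) h4.le
          exact mul_le_mul_of_nonneg_left (pow_le_pow_left₀ h3 (one_sub_norm_le_rho hx') _) hC0.le
      _ = _ := by rw [h5]; ring
  refine ⟨y + 0, (hy.add hR1).congr' ?_⟩
  filter_upwards [eventually_mem_punctured ξ] with x hx
  have hρ := rho_pos hx.1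
  rw [e hx, Real.rpow_sub hρ, Real.rpow_sub hρ, Real.rpow_neg hρ.le]
  field_simp

/-! ### Existence of the boundary values of small index -/

/-- Each summand of `U` has its exponent raised by one half of the list and merely preserved by the
other half. -/
theorem HasExpansion.prodD_append {a b b' γ : ℝ} {i j : ℕ} {M : ℕ} (hM : 1 ≤ M)
    (hj : j ≤ ⌊γ⌋₊) {u : Amb n → ℝ} (hb : b = (n : ℝ) / 2 - γ ∧ b' = b + 2 * i ∨
      b = (n : ℝ) / 2 + γ - 2 * ⌊γ⌋₊ ∧ b' = b + 2 * j)
    (h : HasExpansion b a (4 ^ (i + j) * M) u) :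
    HasExpansion b' a M
      (PoincareBall.prodD n γ (List.range i ++ List.Ico (⌊γ⌋₊ - j + 1) (⌊γ⌋₊ + 1)) u) := by
  have hlen : (List.Ico (⌊γ⌋₊ - j + 1) (⌊γ⌋₊ + 1)).length = j := by
    simp
    omega
  have h4 : ∀ m : ℕ, 1 ≤ 4 ^ m * M := fun m => Nat.mul_pos (by positivity) hM
  have e : 4 ^ (i + j) * M = 4 ^ j * (4 ^ i * M) := by ring
  rw [e] at h
  rw [PoincareBall.prodD_append]
  rcases hb with ⟨rfl, rfl⟩ | ⟨rfl, rfl⟩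
  · exact HasExpansion.prodD_range hM i
      (HasExpansion.prodD (h4 i) _ (by rwa [hlen]))
  · refine HasExpansion.prodD hM _ ?_
    rw [List.length_range]
    exact HasExpansion.prodD_Ico (h4 i) hj h

theorem exists_tendsto_prodD {γ : ℝ} (hγ : 0 < γ) {U : Amb n → ℝ} (hU : MemC n γ U) {i j : ℕ}
    (hj : j ≤ ⌊γ⌋₊) {b₀ : ℝ} (hb1 : b₀ ≤ (n : ℝ) / 2 - γ + 2 * i)
    (hb2 : b₀ ≤ (n : ℝ) / 2 + γ - 2 * ⌊γ⌋₊ + 2 * j) (ξ : Sph n) :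
    ∃ y, Tendsto (fun x => rho x ^ (-b₀) *
      prodD n γ (List.range i ++ List.Ico (⌊γ⌋₊ - j + 1) (⌊γ⌋₊ + 1)) (weighted n γ U) x)
      (𝓝[openBall n] (ξ : Amb n)) (𝓝 y) := by
  obtain ⟨A, B, hA, hB, hAB⟩ := hU
  set L := List.range i ++ List.Ico (⌊γ⌋₊ - j + 1) (⌊γ⌋₊ + 1) with hL
  obtain ⟨M, hM⟩ := exists_nat_gt (max 1 (max (b₀ - ((n : ℝ) / 2 - γ))
    (b₀ - ((n : ℝ) / 2 + γ - 2 * ⌊γ⌋₊))))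
  rw [max_lt_iff, max_lt_iff] at hM
  obtain ⟨hM0, hM1, hM2⟩ := hM
  have hM0' : 1 ≤ M := by exact_mod_cast hM0.le
  -- The initial order is `4 ^ (i + j) * M` because each of the `i + j` factors divides it by four.
  have h1 := hA.hasExpansion ((n : ℝ) / 2 - γ) (4 ^ (i + j) * M)
  have h2 := hB.hasExpansion ((n : ℝ) / 2 + γ - 2 * ⌊γ⌋₊) (4 ^ (i + j) * M)
  obtain ⟨y1, hy1⟩ := (HasExpansion.prodD_append hM0' hj (Or.inl ⟨rfl, rfl⟩) h1).exists_tendsto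
    hb1 (by linarith) ξ
  obtain ⟨y2, hy2⟩ := (HasExpansion.prodD_append hM0' hj (Or.inr ⟨rfl, rfl⟩) h2).exists_tendsto
    hb2 (by linarith) ξ
  have e : EqOn (weighted n γ U) (fun x => rho x ^ ((n : ℝ) / 2 - γ) * A x +
      1 * (rho x ^ ((n : ℝ) / 2 + γ - 2 * ⌊γ⌋₊) * B x)) (punctured n) := by
    intro x hx
    have hρ := rho_pos hx.1
    have hexp : (n : ℝ) / 2 + γ - 2 * ⌊γ⌋₊ = (n : ℝ) / 2 - γ + 2 * Int.fract γ := by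
      rw [fract_eq_sub_natFloor hγ]; ring
    simp only [weighted]
    rw [hAB x (ball_subset_closedBall hx.1), hexp, Real.rpow_add hρ]
    ring
  have e2 := (prodD_congr γ L isOpen_punctured e).trans (prodD_add_const_mul γ L isOpen_punctured 1
    (contDiffOn_infty.1 h1.contDiffOn _) (contDiffOn_infty.1 h2.contDiffOn _))
  refine ⟨y1 + y2, (hy1.add hy2).congr' ?_⟩
  filter_upwards [eventually_mem_punctured ξ] with x hx
  rw [e2 hx]
  ring

theorem hasTrace_evenLowInterior {γ : ℝ} (hγ : 0 < γ) {U : Amb n → ℝ} (hU : MemC n γ U) {j : ℕ}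
    (hj : j ≤ ⌊γ / 2⌋₊) : HasTrace (evenLowInterior n γ j U) := by
  intro ξ
  rw [floor_half] at hj
  have h := exists_tendsto_prodD hγ hU (i := j) (j := j) (by omega)
    (b₀ := (n : ℝ) / 2 - γ + 2 * j) le_rfl (by linarith [Nat.floor_le hγ.le]) ξ
  obtain ⟨y, hy⟩ := h
  refine ⟨y, hy.congr fun x => ?_⟩
  unfold evenLowInterior
  congr 2
  ring

theorem hasTrace_fracLowInterior {γ : ℝ} (hγ : 0 < γ) {U : Amb n → ℝ} (hU : MemC n γ U) {j : ℕ}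
    (hj : j < ⌊γ⌋₊ - ⌊γ / 2⌋₊) : HasTrace (fracLowInterior n γ j U) := by
  intro ξ
  rw [floor_half] at hj
  -- The extra factor `l = j` lifts the first summand to exponent `n/2 - γ + 2j + 2`, which reaches
  -- the weight since `[γ] < 1`.
  have h := exists_tendsto_prodD hγ hU (i := j + 1) (j := j) (by omega)
    (b₀ := (n : ℝ) / 2 + γ - 2 * ⌊γ⌋₊ + 2 * j)
    (by push_cast; linarith [Nat.lt_floor_add_one γ]) le_rfl ξ
  obtain ⟨y, hy⟩ := h
  refine ⟨y, hy.congr fun x => ?_⟩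
  unfold fracLowInterior
  congr 2
  rw [fract_eq_sub_natFloor hγ]
  ring

/-! ### The polyharmonic extension of a solution -/

/-- All Gamma arguments are positive. With `bFracLow_ne_zero`, this lets equality of boundary
operators pass to equality of traces. -/
theorem bEvenLow_ne_zero {γ : ℝ} (hγ : 0 < γ) {j : ℕ} (hj : j ≤ ⌊γ / 2⌋₊) : bEvenLow γ j ≠ 0 := by
  rw [floor_half] at hj
  have h1 : (2 * j : ℝ) ≤ ⌊γ⌋₊ := by exact_mod_cast (by omega : 2 * j ≤ ⌊γ⌋₊)
  have h2 := Nat.floor_le hγ.le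
  have h3 := Int.fract_lt_one γ
  have h4 : (0 : ℝ) ≤ j := Nat.cast_nonneg j
  have g : ∀ {x : ℝ}, 0 < x → Real.Gamma x ≠ 0 := fun hx => (Real.Gamma_pos_of_pos hx).ne'
  unfold bEvenLow
  refine mul_ne_zero (mul_ne_zero (mul_ne_zero (mul_ne_zero (by positivity) (by positivity))
    (div_ne_zero (g ?_) (g ?_))) (div_ne_zero (g ?_) (g ?_))) (div_ne_zero (g ?_) (g ?_)) <;>
  linarith

theorem bFracLow_ne_zero {γ : ℝ} (hγ : 0 < γ) (hγN : ∀ m : ℕ, γ ≠ m) {j : ℕ}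
    (hj : j < ⌊γ⌋₊ - ⌊γ / 2⌋₊) : bFracLow γ j ≠ 0 := by
  rw [floor_half] at hj
  have h1 : (2 * j + 1 : ℝ) ≤ ⌊γ⌋₊ := by exact_mod_cast (by omega : 2 * j + 1 ≤ ⌊γ⌋₊)
  have h2 : (⌊γ⌋₊ : ℝ) < γ := lt_of_le_of_ne (Nat.floor_le hγ.le) (hγN _).symm
  have h3 := Int.fract_lt_one γ
  have h5 : 0 < Int.fract γ := by rw [fract_eq_sub_natFloor hγ]; linarith
  have h4 : (0 : ℝ) ≤ j := Nat.cast_nonneg j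
  have g : ∀ {x : ℝ}, 0 < x → Real.Gamma x ≠ 0 := fun hx => (Real.Gamma_pos_of_pos hx).ne'
  unfold bFracLow
  refine neg_ne_zero.2 (mul_ne_zero (mul_ne_zero (mul_ne_zero (mul_ne_zero (by positivity)
    (by positivity)) (div_ne_zero (g ?_) (g ?_))) (div_ne_zero (g ?_) (g ?_)))
    (div_ne_zero (g ?_) (g ?_))) <;>
  linarith

theorem sphere_nhdsWithin_neBot (ξ : Sph n) : (𝓝[openBall n] (ξ : Amb n)).NeBot := by
  rw [← mem_closure_iff_nhdsWithin_neBot, closure_ball _ one_ne_zero]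
  exact sphere_subset_closedBall ξ.2

theorem tendsto_trace {F : Amb n → ℝ} (hF : HasTrace F) (ξ : Sph n) :
    Tendsto F (𝓝[openBall n] (ξ : Amb n)) (𝓝 (trace F ξ)) :=
  tendsto_nhds_limUnder (hF ξ)

theorem trace_eq_zero {F : Amb n → ℝ} (hF : ∀ x ∈ openBall n, F x = 0) (ξ : Sph n) :
    Tendsto F (𝓝[openBall n] (ξ : Amb n)) (𝓝 0) ∧ trace F ξ = 0 := by
  have h : Tendsto F (𝓝[openBall n] (ξ : Amb n)) (𝓝 0) := by
    refine tendsto_const_nhds.congr' ?_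
    filter_upwards [self_mem_nhdsWithin] with x hx using (hF x hx).symm
  have := sphere_nhdsWithin_neBot ξ
  exact ⟨h, h.limUnder_eq⟩

/-- A solution in `𝒞^{2γ}` is determined by its boundary data of small index. -/
theorem IsPolyExt.eqOn (hn : 1 ≤ n) {γ : ℝ} (hγ : 0 < γ) (hγN : ∀ m : ℕ, γ ≠ m)
    {U V : Amb n → ℝ} (hU : MemC n γ U) (hL : SolvesL n γ U) (hV : IsPolyExt n γ U V) :
    EqOn U V (openBall n) := by
  obtain ⟨hVC, hVL, hE, hF⟩ := hV
  let w : Amb n → ℝ := fun x => weighted n γ U x + -1 * weighted n γ V x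
  have hw : ContDiffOn ℝ ((2 * (⌊γ⌋₊ + 1) : ℕ) : WithTop ℕ∞) w (openBall n) :=
    hL.1.add (contDiffOn_const.mul hVL.1)
  have hlin : ∀ L : List ℕ, L.length ≤ ⌊γ⌋₊ + 1 → EqOn (prodD n γ L w)
      (fun x => prodD n γ L (weighted n γ U) x + -1 * prodD n γ L (weighted n γ V) x)
      (openBall n) := by
    intro L hlen
    have hle : ((2 * L.length : ℕ) : WithTop ℕ∞) ≤ ((2 * (⌊γ⌋₊ + 1) : ℕ) : WithTop ℕ∞) := by
      exact_mod_cast (by omega : 2 * L.length ≤ 2 * (⌊γ⌋₊ + 1))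
    exact prodD_add_const_mul γ L isOpen_ball (-1) (hL.1.of_le hle) (hVL.1.of_le hle)
  have hsol : ∀ {W : Amb n → ℝ}, SolvesL n γ W → ∀ x ∈ openBall n,
      prodD n γ (List.range (⌊γ⌋₊ + 1)) (weighted n γ W) x = 0 := fun hW x hx =>
    (mul_eq_zero.1 (hW.2 x hx)).resolve_left (Real.rpow_pos_of_pos (rho_pos hx) _).ne'
  have hw0 := eq_zero_of_boundary_values hn hγ hγN hw (fun x hx => by
      rw [hlin _ (by simp) hx]
      simp only [hsol hL x hx, hsol hVL x hx]
      ring)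
    (fun j hj ξ => by
      -- `trace` is a `limUnder`, so equality of traces gives a vanishing limit of the difference
      -- only because both limits exist.
      have h1 := tendsto_trace (hasTrace_evenLowInterior hγ hU hj) ξ
      have h2 := tendsto_trace (hasTrace_evenLowInterior hγ hVC hj) ξ
      have h3 := hE j hj ξ
      unfold bdryEvenLow at h3
      rw [mul_right_inj' (one_div_ne_zero (bEvenLow_ne_zero hγ hj))] at h3
      have h4 := h1.sub h2
      rw [h3, sub_self] at h4
      refine h4.congr' ?_
      filter_upwards [self_mem_nhdsWithin] with x hx
      rw [floor_half] at hj
      rw [hlin _ (by rw [length_evenLowList γ (by omega)]; omega) hx]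
      unfold evenLowInterior
      ring)
    (fun j hj ξ => by
      have h1 := tendsto_trace (hasTrace_fracLowInterior hγ hU hj) ξ
      have h2 := tendsto_trace (hasTrace_fracLowInterior hγ hVC hj) ξ
      have h3 := hF j hj ξ
      unfold bdryFracLow at h3
      rw [mul_right_inj' (div_ne_zero (by norm_num) (bFracLow_ne_zero hγ hγN hj))] at h3
      have h4 := h1.sub h2
      rw [h3, sub_self] at h4
      refine h4.congr' ?_
      filter_upwards [self_mem_nhdsWithin] with x hx
      rw [floor_half] at hj
      rw [hlin _ (by rw [length_fracLowList γ (by omega)]; omega) hx]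
      unfold fracLowInterior
      ring)
  intro x hx
  have h1 : rho x ^ ((n : ℝ) / 2 - γ) * (U x - V x) = 0 := by
    have := hw0 x hx
    simp only [w, weighted] at this
    linarith
  exact sub_eq_zero.1 ((mul_eq_zero.1 h1).resolve_left (Real.rpow_pos_of_pos (rho_pos hx) _).ne')

/-- `U` has its own boundary data, so the choice in `polyExt` is made from a nonempty set, and
uniqueness makes it immaterial. -/
theorem polyExt_eqOn (hn : 1 ≤ n) {γ : ℝ} (hγ : 0 < γ) (hγN : ∀ m : ℕ, γ ≠ m)
    {U : Amb n → ℝ} (hU : MemC n γ U) (hL : SolvesL n γ U) :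
    EqOn U (polyExt n γ U) (openBall n) := by
  have h : ∃ V, IsPolyExt n γ U V := ⟨U, hU, hL, fun _ _ _ => rfl, fun _ _ _ => rfl⟩
  refine IsPolyExt.eqOn hn hγ hγN hU hL ?_
  rw [polyExt, dif_pos h]
  exact h.choose_spec

theorem prodD_weighted_sub_polyExt (hn : 1 ≤ n) {γ : ℝ} (hγ : 0 < γ) (hγN : ∀ m : ℕ, γ ≠ m)
    {U : Amb n → ℝ} (hU : MemC n γ U) (hL : SolvesL n γ U) (L : List ℕ) :
    ∀ x ∈ openBall n, prodD n γ L (weighted n γ (U - polyExt n γ U)) x = 0 := by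
  intro x hx
  have h0 : EqOn (weighted n γ (U - polyExt n γ U)) (fun _ => 0) (openBall n) := fun y hy => by
    simp [weighted, polyExt_eqOn hn hγ hγN hU hL hy]
  rw [prodD_congr γ L isOpen_ball h0 hx]
  have hc : ContDiffOn ℝ ((2 * L.length : ℕ) : WithTop ℕ∞) (fun _ : Amb n => (0 : ℝ))
    (openBall n) := contDiffOn_const
  have h1 := prodD_add_const_mul γ L isOpen_ball (-1) hc hc hx
  simp only [mul_zero, add_zero] at h1
  rw [h1]
  ring

end PoincareBall

end

theorem theorem1p4 (n : ℕ) (hn : 1 ≤ n) (γ : ℝ) (hγ : 0 < γ) (hγN : ∀ m : ℕ, γ ≠ m)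
    (U : Amb n → ℝ) (hU : MemC n γ U) (hL : SolvesL n γ U) :
    BoundaryValuesExist n γ U ∧
    (∀ j : ℕ, j ≤ ⌊γ / 2⌋₊ → ∀ ξ : Sph n,
      bdryFrac n γ (⌊γ⌋₊ - j) U ξ =
        1 / cConst (γ - 2 * j) * gjms n (γ - 2 * j) (bdryEven n γ j U) ξ) ∧
    (∀ j : ℕ, j < ⌊γ⌋₊ - ⌊γ / 2⌋₊ → ∀ ξ : Sph n,
      bdryEven n γ (⌊γ⌋₊ - j) U ξ =
        1 / cConst (⌊γ⌋₊ - Int.fract γ - 2 * j) *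
          gjms n (⌊γ⌋₊ - Int.fract γ - 2 * j) (bdryFrac n γ j U) ξ) := by
  have hz := prodD_weighted_sub_polyExt hn hγ hγN hU hL
  have hEH : ∀ (j : ℕ), ∀ x ∈ openBall n, evenHighInterior n γ j U x = 0 := fun j x hx => by
    rw [evenHighInterior, opPi, hz _ x hx, mul_zero]
  have hFH : ∀ (j : ℕ), ∀ x ∈ openBall n, fracHighInterior n γ j U x = 0 := fun j x hx => by
    rw [fracHighInterior, opPi, hz _ x hx, mul_zero]
  have hfl := floor_half γ
  have hfr := fract_eq_sub_natFloor hγ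
  refine ⟨⟨fun j hj => hasTrace_evenLowInterior hγ hU hj,
    fun j hj => hasTrace_fracLowInterior hγ hU hj,
    fun j _ _ ξ => ⟨0, (trace_eq_zero (hEH j) ξ).1⟩,
    fun j _ _ ξ => ⟨0, (trace_eq_zero (hFH j) ξ).1⟩⟩, fun j hj ξ => ?_, fun j hj ξ => ?_⟩
  -- For `j ≤ ⌊γ/2⌋₊` the index `⌊γ⌋₊ - j` is in the large range. Its trace term is zero, and the
  -- GJMS term in its definition involves the small-index operator of index `j`.
  · have e1 : ⌊γ⌋₊ - (⌊γ⌋₊ - j) = j := by omega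
    have e2 : 2 * ((⌊γ⌋₊ - j : ℕ) : ℝ) + Int.fract γ - ⌊γ⌋₊ = γ - 2 * j := by
      rw [Nat.cast_sub (by omega), hfr]; ring
    rw [bdryFrac, if_neg (by omega), bdryEven, if_pos hj, bdryFracHigh,
      (trace_eq_zero (hFH _) ξ).2, e1, e2, mul_zero, zero_add]
  · have e1 : ⌊γ⌋₊ - (⌊γ⌋₊ - j) = j := by omega
    have e2 : 2 * ((⌊γ⌋₊ - j : ℕ) : ℝ) - γ = ⌊γ⌋₊ - Int.fract γ - 2 * j := by
      rw [Nat.cast_sub (by omega), hfr]; ring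
    rw [bdryEven, if_neg (by omega), bdryFrac, if_pos hj, bdryEvenHigh,
      (trace_eq_zero (hEH _) ξ).2, e1, e2, mul_zero, zero_add]
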